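/- **Theorem 4.** Let $d\ge 1$ and let $X=(X_1,\dots,X_d)$ be a random vector in $\mathbb{R}^d$ with i.i.d. coordinates which is infinitely divisible without Gaussian component, i.e., for all $t\in\mathbb{R}^d$, $$\mathbb{E}e^{i\langle t,X\rangle}=\exp\Big\{i\langle t,\gamma\rangle+\int_{\mathbb{R}^d}\big(e^{i\langle t,u\rangle}-1-i\langle t,u\rangle\mathbf{1}_{\|u\|_2\le 1}\big)\,\nu(du)\Big\},$$ where $\gamma\in\mathbb{R}^d$ and $\nu\neq 0$ is a Lévy measure on $\mathbb{R}^d$ (a Borel measure with $\nu(\{0\})=0$ and $\int(1\wedge\|u\|_2^2)\,\nu(du)<\infty$) of the form $$\nu(dx_1,\dots,dx_d)=\sum_{k=1}^d\delta_0(dx_1)\cdots\delta_0(dx_{k-1})\,\tilde\nu(dx_k)\,\delta_0(dx_{k+1})\cdots\delta_0(dx_d)$$ for a Lévy measure $\tilde\nu$ on $\mathbb{R}$. Assume that $\mathbb{E}e^{t\|X\|_2}<\infty$ for some $t>0$, let $M=\sup\{t>0:\mathbb{E}e^{t|X_1|}<\infty\}\in(0,\infty]$, let $\varepsilon>0$,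 and for $0\le t<M$ put $$h(t)=8\int_{\mathbb{R}}|u|(e^{t|u|}-1)\,\tilde\nu(du)+\frac{2d}{(\varepsilon\,\mathbb{E}\|X\|_2)^2}\int_{\mathbb{R}}|u|^3(e^{t|u|}-1)\,\tilde\nu(du).$$ Then all the quantities in this formula are well defined and finite, $\mathbb{E}\|X\|_2>0$, the left limit $h(M^-)=\lim_{t\uparrow M}h(t)\in(0,\infty]$ exists, $h$ is a bijection from $[0,M)$ onto $[0,h(M^-))$, with inverse $h^{-1}$, and for all $0<x<h(M^-)$ the function $h^{-1}$ is integrable on $[0,x]$ and $$\mathbb{P}\big(\|X\|_2\ge(1+\varepsilon)\mathbb{E}\|X\|_2+x\big)\le\exp\Big(-\int_0^x h^{-1}(s)\,ds\Big).$$ Moreover, $h$ is bounded above and below independently of the dimension $d$: $\mathbb{E}|X_1|>0$, $\mathbb{E}X_1^2<\infty$ and, for all $0\le t<M$, $$8\int_{\mathbb{R}}|u|(e^{t|u|}-1)\,\tilde\nu(du)+\frac{2}{\varepsilon^2\,\mathbb{E}X_1^2}\int_{\mathbb{R}}|u|^3(e^{t|u|}-1)\,\tilde\nu(du)\;\le\;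 h(t)\;\le\; 8\int_{\mathbb{R}}|u|(e^{t|u|}-1)\,\tilde\nu(du)+\frac{2}{\varepsilon^2(\mathbb{E}|X_1|)^2}\int_{\mathbb{R}}|u|^3(e^{t|u|}-1)\,\tilde\nu(du).$$ -/

import Mathlib

open MeasureTheory ProbabilityTheory Filter Topology Set

/-- A Lévy measure: a Borel measure without atom at the origin that integrates `1 ∧ ‖u‖²`. -/
structure IsLevyMeasure {E : Type*} [NormedAddCommGroup E] [MeasurableSpace E]
    (ν : Measure E) : Prop where
  no_atom_zero : ν {0} = 0
  lintegral_lt_top : ∫⁻ u, ENNReal.ofReal (min 1 (‖u‖ ^ 2)) ∂ν < ⊤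

/-- The Lévy–Khintchine exponent, at the frequency `t`, of the triplet `(γ, 0, ν)`, with the
truncation function `1_{‖u‖ ≤ 1}`. -/
noncomputable def levyExponent {d : ℕ} (γ : EuclideanSpace ℝ (Fin d))
    (ν : Measure (EuclideanSpace ℝ (Fin d))) (t : EuclideanSpace ℝ (Fin d)) : ℂ :=
  Complex.I * ((inner ℝ t γ : ℝ) : ℂ) +
    ∫ u, (Complex.exp (Complex.I * ((inner ℝ t u : ℝ) : ℂ)) - 1 -
      Complex.I * ((inner ℝ t u : ℝ) : ℂ) * (if ‖u‖ ≤ 1 then 1 else 0)) ∂ν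

/-- `X ∼ ID(γ, 0, ν)` under `P`: the law of `X` is infinitely divisible, without Gaussian
component, with drift `γ` and nonzero Lévy measure `ν`. -/
structure IsID {Ω : Type*} [MeasurableSpace Ω] (P : Measure Ω) {d : ℕ}
    (X : Ω → EuclideanSpace ℝ (Fin d)) (γ : EuclideanSpace ℝ (Fin d))
    (ν : Measure (EuclideanSpace ℝ (Fin d))) : Prop where
  measurable : Measurable X
  isLevyMeasure : IsLevyMeasure ν
  ne_zero : ν ≠ 0
  charFun_eq : ∀ t : EuclideanSpace ℝ (Fin d),
    ∫ ω, Complex.exp (Complex.I * ((inner ℝ t (X ω) : ℝ) : ℂ)) ∂P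
      = Complex.exp (levyExponent γ ν t)

/-- The measure on `ℝ^d` carried by the coordinate axes whose part on each axis is `ν₁`, i.e.
`∑ₖ δ₀(dx₁) ⋯ δ₀(dxₖ₋₁) ν₁(dxₖ) δ₀(dxₖ₊₁) ⋯ δ₀(dx_d)`. -/
noncomputable def axisMeasure (d : ℕ) (ν₁ : Measure ℝ) : Measure (EuclideanSpace ℝ (Fin d)) :=
  ∑ k : Fin d, ν₁.map (fun u : ℝ => EuclideanSpace.single k u)

/-- `sup {t > 0 : 𝔼 e^{t|Y|} < ∞}`, which may be `+∞`. -/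
noncomputable def expMomentSup {Ω : Type*} [MeasurableSpace Ω] (P : Measure Ω) (Y : Ω → ℝ) :
    EReal :=
  sSup ((fun t : ℝ => (t : EReal)) ''
    {t : ℝ | 0 < t ∧ Integrable (fun ω => Real.exp (t * |Y ω|)) P})

/-! The proof is a Chernoff bound whose exponent is computed on the jumps. If $\int
(e^{\Delta}-1-\Delta)\,d\nu\le\kappa$ for the increments $\Delta=F(y+u)-F(y)$, uniformly in $y$,
then $\mathbb{E}e^{F(X)}\le e^{\kappa+\mathbb{E}F(X)}$ (`IsID.integral_exp_le`). For a random walk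
this follows by induction on the steps (`integral_exp_convPow_le`): averaging $F$ over a step
preserves the hypothesis by Jensen. It passes to $X$ because walks with steps
$(1-\nu_n(E)/N)\delta_0+\nu_n/N$, where $\nu_n$ keeps the jumps larger than $1/(n+1)$, converge in
law to $X$ once drifted.

The function used is $F=T\min(\max(\|\cdot\|,a),b)$ with $a=\varepsilon\mathbb{E}\|X\|$. Jumps lie
on the axes, so the quantity to bound is a sum over coordinates. The increment of the norm along $u
e_k$ is at most $|2x_ku+u^2|/\max(\|x\|,a)$, and the squares sum to at most $8u^2+2du^4/a^2$
(`sum_sq_truncNorm_add_single_sub_le`): this gives the two integrals in $h$. Since $(e^y-1-y)/y^2$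
is largest at $y=T|u|$ on $|y|\le T|u|$, one may take $\kappa=K(T)$, where $K$ is `levyLog`. The
lower truncation costs the term $\varepsilon\mathbb{E}\|X\|$ in the mean, whence the factor
$1+\varepsilon$.

The tail is then at most $e^{K(T)-Tx}$. As $h$ is a subgradient of $K$, the choice $T=h^{-1}(x)$
gives $Tx-K(T)\ge\int_0^xh^{-1}$ (`integral_invFunOn_le`).

Finiteness of $h$ on $[0,M)$ requires exponential moments of $X$ to pass to the large jumps; they
do, because suppressing jumps larger than $R$ bounds $\mathbb{E}e^{\langle v,X\rangle}$ below,
uniformly in $R$ (`IsID.integrableOn_exp_inner`). -/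

/-- The `n`-fold convolution power of a measure. -/
noncomputable def convPow {E : Type*} [AddMonoid E] [MeasurableSpace E] (μ : Measure E) :
    ℕ → Measure E
  | 0 => Measure.dirac 0
  | n + 1 => (convPow μ n).conv μ

/-! ### Convolution powers and exponential moments of random walks. -/

section ConvPow

variable {E : Type*} [AddCommGroup E] [MeasurableSpace E] [MeasurableAdd₂ E]

instance isFiniteMeasure_convPow (μ : Measure E) [IsFiniteMeasure μ] (n : ℕ) :
    IsFiniteMeasure (convPow μ n) := by
  induction n with
  | zero => rw [convPow]; infer_instance
  | succ n ih => rw [convPow]; infer_instance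

instance isProbabilityMeasure_convPow (μ : Measure E) [IsProbabilityMeasure μ] (n : ℕ) :
    IsProbabilityMeasure (convPow μ n) := by
  induction n with
  | zero => rw [convPow]; infer_instance
  | succ n ih => rw [convPow]; infer_instance

/-- Serves to compare the walk with its large jumps suppressed to the full walk. -/
theorem convPow_mono {μ μ' : Measure E} [IsFiniteMeasure μ] [IsFiniteMeasure μ'] (h : μ ≤ μ')
    (n : ℕ) : convPow μ n ≤ convPow μ' n := by
  induction n with
  | zero => exact le_rfl
  | succ n ih =>
    rw [convPow, convPow, Measure.conv, Measure.conv]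
    exact Measure.map_mono (Measure.prod_mono ih h) measurable_add

theorem integral_convPow_of_mul {χ : E → ℂ} (h0 : χ 0 = 1) (hadd : ∀ x y, χ (x + y) = χ x * χ y)
    (hm : Measurable χ) (μ : Measure E) [IsFiniteMeasure μ] (hi : Integrable χ μ) (n : ℕ) :
    Integrable χ (convPow μ n) ∧ ∫ x, χ x ∂(convPow μ n) = (∫ x, χ x ∂μ) ^ n := by
  induction n with
  | zero =>
    refine ⟨?_, ?_⟩
    · rw [convPow]
      exact integrable_dirac' hm.stronglyMeasurable (by simp)
    · rw [convPow, integral_dirac' _ _ hm.stronglyMeasurable, h0, pow_zero]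
  | succ n ih =>
    have h1 : Integrable χ ((convPow μ n).conv μ) := by
      rw [integrable_conv_iff hm.aestronglyMeasurable]
      simp only [hadd, norm_mul]
      refine ⟨.of_forall fun x => hi.const_mul _, ?_⟩
      simp only [integral_const_mul]
      exact ih.1.norm.mul_const _
    refine ⟨by rw [convPow]; exact h1, ?_⟩
    rw [convPow, integral_conv h1]
    simp only [hadd, integral_const_mul, integral_mul_const, ih.2]
    rw [pow_succ]

theorem integrable_of_measurable_of_abs_le {α : Type*} [MeasurableSpace α] {μ : Measure α}
    [IsFiniteMeasure μ] {F : α → ℝ} (hF : Measurable F) {B : ℝ} (hB : ∀ x, |F x| ≤ B) :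
    Integrable F μ :=
  Integrable.of_bound hF.aestronglyMeasurable B (.of_forall fun x => hB x)

theorem exp_sub_one_sub_nonneg (y : ℝ) : 0 ≤ Real.exp y - 1 - y := by
  linarith [Real.add_one_le_exp y]

theorem convexOn_exp_sub_one_sub : ConvexOn ℝ univ fun y : ℝ => Real.exp y - 1 - y := by
  have h := (convexOn_exp.add (convexOn_const (-1) convex_univ)).sub (concaveOn_id convex_univ)
  refine h.congr fun y _ => ?_
  simp [sub_eq_add_neg]

theorem abs_exp_sub_one_sub_le {y B : ℝ} (h : |y| ≤ B) :
    |Real.exp y - 1 - y| ≤ Real.exp B := by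
  rw [abs_of_nonneg (exp_sub_one_sub_nonneg y)]
  have h1 := Real.exp_le_exp.2 ((le_abs_self y).trans h)
  have h2 := Real.exp_le_exp.2 h
  have h3 := Real.add_one_le_exp |y|
  rcases le_total 0 y with hy | hy
  · linarith [Real.add_one_le_exp y]
  · have : Real.exp y ≤ 1 := Real.exp_le_one_iff.2 hy
    rw [abs_of_nonpos hy] at *
    linarith

/-- One-step exponential moment bound. -/
theorem integral_exp_le_exp_add_integral {α : Type*} [MeasurableSpace α] (ρ : Measure α)
    [IsProbabilityMeasure ρ] {F : α → ℝ} (hF : Measurable F) {B : ℝ} (hB : ∀ x, |F x| ≤ B)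
    (y κ : ℝ) (hκ : ∫ u, (Real.exp (F u - y) - 1 - (F u - y)) ∂ρ ≤ κ) :
    ∫ u, Real.exp (F u) ∂ρ ≤ Real.exp (κ + ∫ u, F u ∂ρ) := by
  have hFi := integrable_of_measurable_of_abs_le (μ := ρ) hF hB
  have hei : Integrable (fun u => Real.exp (F u - y)) ρ := by
    refine integrable_of_measurable_of_abs_le (by fun_prop) (B := Real.exp (B - y)) fun u => ?_
    rw [abs_of_pos (Real.exp_pos _)]
    exact Real.exp_le_exp.2 (by linarith [le_abs_self (F u), hB u])
  have h1 : ∫ u, (Real.exp (F u - y) - 1 - (F u - y)) ∂ρ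
      = ∫ u, Real.exp (F u - y) ∂ρ - 1 - (∫ u, F u ∂ρ - y) := by
    rw [integral_sub (f := fun u => Real.exp (F u - y) - 1) (g := fun u => F u - y)
      (hei.sub (integrable_const _)) (hFi.sub (integrable_const _)),
      integral_sub hei (integrable_const _), integral_sub hFi (integrable_const _)]
    simp
  have h2 : ∫ u, Real.exp (F u) ∂ρ = Real.exp y * ∫ u, Real.exp (F u - y) ∂ρ := by
    rw [← integral_const_mul]
    congr 1; ext u; rw [← Real.exp_add]; ring_nf
  rw [h2]
  -- The mean of $e^{F-y}$ is at most $1+w$ with $w=\kappa+\int F-y$, and $1+w\le e^w$.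
  have h3 : ∫ u, Real.exp (F u - y) ∂ρ ≤ Real.exp (κ + (∫ u, F u ∂ρ - y)) := by
    linarith [Real.add_one_le_exp (κ + (∫ u, F u ∂ρ - y))]
  calc _ ≤ Real.exp y * Real.exp (κ + (∫ u, F u ∂ρ - y)) := by gcongr
    _ = _ := by rw [← Real.exp_add]; ring_nf

/-- Averaging a function over translations preserves a bound on the integral of
`e^Δ - 1 - Δ` over its increments `Δ`. -/
theorem integral_increments_average_le (ρ : Measure E) [IsProbabilityMeasure ρ] {F : E → ℝ}
    (hF : Measurable F) {B : ℝ} (hB : ∀ x, |F x| ≤ B) {κ : ℝ}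
    (hκ : ∀ x, ∫ u, (Real.exp (F (x + u) - F x) - 1 - (F (x + u) - F x)) ∂ρ ≤ κ) (x : E) :
    ∫ u, (Real.exp ((∫ v, F (x + u + v) ∂ρ) - ∫ v, F (x + v) ∂ρ) - 1 -
      ((∫ v, F (x + u + v) ∂ρ) - ∫ v, F (x + v) ∂ρ)) ∂ρ ≤ κ := by
  have hi : ∀ x, Integrable (fun v => F (x + v)) ρ := fun x =>
    integrable_of_measurable_of_abs_le (by fun_prop) fun v => hB _
  have hd : ∀ a b, |F a - F b| ≤ 2 * B := fun a b => by
    have := abs_sub (F a) (F b); linarith [hB a, hB b]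
  have hb : ∀ a b, |Real.exp (F a - F b) - 1 - (F a - F b)| ≤ Real.exp (2 * B) := fun a b =>
    abs_exp_sub_one_sub_le (hd a b)
  -- The increment of the averaged function is the average over `v` of the increments of `F` from `x
  -- + v`, so Jensen applies to the convex $e^y-1-y$.
  have hjen : ∀ u, Real.exp ((∫ v, F (x + u + v) ∂ρ) - ∫ v, F (x + v) ∂ρ) - 1 -
      ((∫ v, F (x + u + v) ∂ρ) - ∫ v, F (x + v) ∂ρ) ≤
      ∫ v, (Real.exp (F (x + u + v) - F (x + v)) - 1 - (F (x + u + v) - F (x + v))) ∂ρ := by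
    intro u
    rw [← integral_sub (hi _) (hi _)]
    exact convexOn_exp_sub_one_sub.map_integral_le (by fun_prop) isClosed_univ (by simp)
      ((hi _).sub (hi _))
      (integrable_of_measurable_of_abs_le (by fun_prop) fun v => hb _ _)
  have hprod : Integrable (fun p : E × E => Real.exp (F (x + p.1 + p.2) - F (x + p.2)) - 1 -
      (F (x + p.1 + p.2) - F (x + p.2))) (ρ.prod ρ) :=
    integrable_of_measurable_of_abs_le (by fun_prop) fun v => hb _ _
  have hPm : Measurable fun u => ∫ v, F (x + u + v) ∂ρ := by
    have : Measurable fun p : E × E => F (x + p.1 + p.2) := by fun_prop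
    exact this.stronglyMeasurable.integral_prod_right'.measurable
  have hPb : ∀ a, |∫ v, F (a + v) ∂ρ| ≤ B := fun a => by
    refine (abs_integral_le_integral_abs).trans ?_
    refine (integral_mono (hi a).abs (integrable_const B) fun v => hB _).trans ?_
    simp
  have hli : Integrable (fun u => Real.exp ((∫ v, F (x + u + v) ∂ρ) - ∫ v, F (x + v) ∂ρ) - 1 -
      ((∫ v, F (x + u + v) ∂ρ) - ∫ v, F (x + v) ∂ρ)) ρ := by
    refine integrable_of_measurable_of_abs_le (by fun_prop) (B := Real.exp (2 * B)) fun u => ?_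
    refine abs_exp_sub_one_sub_le ?_
    have := abs_sub (∫ v, F (x + u + v) ∂ρ) (∫ v, F (x + v) ∂ρ)
    linarith [hPb x, hPb (x + u)]
  calc _ ≤ ∫ u, ∫ v, (Real.exp (F (x + u + v) - F (x + v)) - 1 -
        (F (x + u + v) - F (x + v))) ∂ρ ∂ρ :=
        integral_mono hli hprod.integral_prod_left hjen
    _ = ∫ v, ∫ u, (Real.exp (F (x + u + v) - F (x + v)) - 1 -
        (F (x + u + v) - F (x + v))) ∂ρ ∂ρ := integral_integral_swap hprod
    _ ≤ ∫ _, κ ∂ρ := by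
        refine integral_mono hprod.integral_prod_right (integrable_const _) fun v => ?_
        refine le_trans (le_of_eq ?_) (hκ (x + v))
        simp only [add_right_comm x _ v]
    _ = κ := by simp

/-- Exponential moment bound for sums of independent identically distributed jumps. -/
theorem integral_exp_convPow_le (ρ : Measure E) [IsProbabilityMeasure ρ] {κ : ℝ} (n : ℕ)
    {F : E → ℝ} (hF : Measurable F) {B : ℝ} (hB : ∀ x, |F x| ≤ B)
    (hκ : ∀ x, ∫ u, (Real.exp (F (x + u) - F x) - 1 - (F (x + u) - F x)) ∂ρ ≤ κ) :
    ∫ x, Real.exp (F x) ∂(convPow ρ n) ≤ Real.exp (n * κ + ∫ x, F x ∂(convPow ρ n)) := by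
  induction n generalizing F with
  | zero =>
    rw [convPow, integral_dirac' _ _ hF.stronglyMeasurable,
      integral_dirac' _ _ (by fun_prop : Measurable fun x => Real.exp (F x)).stronglyMeasurable]
    simp
  | succ n ih =>
    have hPm : Measurable fun x => ∫ v, F (x + v) ∂ρ := by
      have : Measurable fun p : E × E => F (p.1 + p.2) := by fun_prop
      exact this.stronglyMeasurable.integral_prod_right'.measurable
    have hi : ∀ x, Integrable (fun v => F (x + v)) ρ := fun x =>
      integrable_of_measurable_of_abs_le (by fun_prop) fun v => hB _
    have hPb : ∀ a, |∫ v, F (a + v) ∂ρ| ≤ B := fun a => by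
      refine (abs_integral_le_integral_abs).trans ?_
      refine (integral_mono (hi a).abs (integrable_const B) fun v => hB _).trans ?_
      simp
    have heb : ∀ x, |Real.exp (F x)| ≤ Real.exp B := fun x => by
      rw [abs_of_pos (Real.exp_pos _)]
      exact Real.exp_le_exp.2 ((le_abs_self _).trans (hB x))
    -- The last step is integrated out: the averaged function satisfies the hypothesis with the same
    -- `κ`, which is why the induction runs over all `F`.
    have hIH := ih hPm hPb (integral_increments_average_le ρ hF hB hκ)
    rw [convPow, integral_conv (integrable_of_measurable_of_abs_le hF hB),
      integral_conv (integrable_of_measurable_of_abs_le (by fun_prop) heb)]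
    have hstep : ∀ x, ∫ u, Real.exp (F (x + u)) ∂ρ ≤ Real.exp (κ + ∫ u, F (x + u) ∂ρ) := fun x =>
      integral_exp_le_exp_add_integral ρ (by fun_prop) (fun u => hB (x + u)) (F x) κ (hκ x)
    have hint : Integrable (fun x => Real.exp (κ + ∫ u, F (x + u) ∂ρ)) (convPow ρ n) := by
      refine integrable_of_measurable_of_abs_le (by fun_prop) (B := Real.exp (κ + B)) fun x => ?_
      rw [abs_of_pos (Real.exp_pos _)]
      exact Real.exp_le_exp.2 (by linarith [le_abs_self (∫ u, F (x + u) ∂ρ), hPb x])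
    calc _ ≤ ∫ x, Real.exp (κ + ∫ u, F (x + u) ∂ρ) ∂(convPow ρ n) := by
          refine integral_mono ?_ hint hstep
          have : Integrable (fun p : E × E => Real.exp (F (p.1 + p.2))) ((convPow ρ n).prod ρ) :=
            integrable_of_measurable_of_abs_le (by fun_prop) fun p => heb _
          exact this.integral_prod_left
      _ = Real.exp κ * ∫ x, Real.exp (∫ u, F (x + u) ∂ρ) ∂(convPow ρ n) := by
          simp only [Real.exp_add, integral_const_mul]
      _ ≤ Real.exp κ * Real.exp (n * κ + ∫ x, ∫ u, F (x + u) ∂ρ ∂(convPow ρ n)) := by gcongr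
      _ = _ := by rw [← Real.exp_add]; push_cast; ring_nf

end ConvPow

/-- `(1 + zₙ / Nₙ) ^ Nₙ` is asymptotic to `exp zₙ` as soon as `zₙ² / Nₙ → 0`. -/
theorem tendsto_one_add_div_pow_mul_exp_neg {z : ℕ → ℂ} {N : ℕ → ℕ} (hN : ∀ n, 1 ≤ N n)
    (hz : Tendsto (fun n => ‖z n‖ ^ 2 / N n) atTop (𝓝 0)) :
    Tendsto (fun n => (1 + z n / N n) ^ N n * Complex.exp (-z n)) atTop (𝓝 1) := by
  have hNpos : ∀ n, (0 : ℝ) < N n := fun n => by exact_mod_cast hN n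
  have hw : ∀ n, (N n : ℝ) * ‖z n / N n‖ ^ 2 = ‖z n‖ ^ 2 / N n := fun n => by
    have := (hNpos n).ne'
    rw [norm_div, Complex.norm_natCast]
    field_simp
  have hsmall : ∀ᶠ n in atTop, ‖z n / N n‖ ≤ 1 / 2 := by
    filter_upwards [hz.eventually (gt_mem_nhds (show (0 : ℝ) < 1 / 4 by norm_num))] with n hn
    rw [← hw] at hn
    have h1 : (1 : ℝ) ≤ N n := by exact_mod_cast hN n
    nlinarith [norm_nonneg (z n / N n), sq_nonneg ‖z n / N n‖]
  have hlim : Tendsto (fun n => (N n : ℂ) * (Complex.log (1 + z n / N n) - z n / N n)) atTop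
      (𝓝 0) := by
    refine squeeze_zero_norm' ?_ hz
    filter_upwards [hsmall] with n hn
    have h1 := Complex.norm_log_one_add_sub_self_le (z := z n / N n) (by linarith)
    have h2 : (1 - ‖z n / N n‖)⁻¹ ≤ 2 := by
      rw [inv_le_comm₀ (by linarith) (by norm_num)]; linarith
    rw [norm_mul, Complex.norm_natCast, ← hw]
    refine mul_le_mul_of_nonneg_left (h1.trans ?_) (hNpos n).le
    nlinarith [sq_nonneg ‖z n / N n‖]
  have hexp := (Complex.continuous_exp.tendsto 0).comp hlim
  rw [Complex.exp_zero] at hexp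
  refine hexp.congr' ?_
  filter_upwards [hsmall] with n hn
  have hne : 1 + z n / N n ≠ 0 := by
    intro h
    have : z n / N n = -1 := by linear_combination h
    rw [this] at hn
    norm_num at hn
  have hNc : (N n : ℂ) ≠ 0 := by exact_mod_cast (hNpos n).ne'
  rw [Function.comp_apply, mul_sub, sub_eq_add_neg, Complex.exp_add, Complex.exp_nat_mul,
    Complex.exp_log hne, mul_div_cancel₀ _ hNc]

/-! ### Truncation of small jumps and the steps of the approximating walks. -/

section LevyMeasure

variable {E : Type*} [NormedAddCommGroup E] [MeasurableSpace E] [BorelSpace E] {ν : Measure E}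

theorem IsLevyMeasure.integrable_min (hν : IsLevyMeasure ν) :
    Integrable (fun u : E => min 1 (‖u‖ ^ 2)) ν := by
  refine ⟨by fun_prop, ?_⟩
  rw [hasFiniteIntegral_iff_ofReal (.of_forall fun u => by positivity)]
  exact hν.lintegral_lt_top

theorem IsLevyMeasure.integrable_of_norm_le (hν : IsLevyMeasure ν) {F : Type*}
    [NormedAddCommGroup F] {f : E → F} (hf : AEStronglyMeasurable f ν) {C : ℝ}
    (hC : ∀ u, ‖f u‖ ≤ C * min 1 (‖u‖ ^ 2)) : Integrable f ν :=
  (hν.integrable_min.const_mul C).mono' hf (.of_forall hC)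

theorem IsLevyMeasure.measure_lt_norm_lt_top (hν : IsLevyMeasure ν) {δ : ℝ} (hδ : 0 < δ) :
    ν {u | δ < ‖u‖} < ⊤ := by
  have h := hν.integrable_min.measure_ge_lt_top (ε := min 1 (δ ^ 2)) (by positivity)
  refine lt_of_le_of_lt (measure_mono fun u hu => ?_) h
  have hu : δ < ‖u‖ := hu
  show min 1 (δ ^ 2) ≤ min 1 (‖u‖ ^ 2)
  gcongr

/-- The restriction of `ν` to the jumps of size larger than `1 / (n + 1)`. -/
noncomputable def bigJumps (ν : Measure E) (n : ℕ) : Measure E :=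
  ν.restrict {u | 1 / ((n : ℝ) + 1) < ‖u‖}

theorem measurableSet_lt_norm (δ : ℝ) : MeasurableSet {u : E | δ < ‖u‖} :=
  measurableSet_lt measurable_const measurable_norm

theorem IsLevyMeasure.isFiniteMeasure_bigJumps (hν : IsLevyMeasure ν) (n : ℕ) :
    IsFiniteMeasure (bigJumps ν n) :=
  ⟨by simpa [bigJumps] using hν.measure_lt_norm_lt_top (by positivity : (0 : ℝ) < 1 / (n + 1))⟩

theorem IsLevyMeasure.tendsto_integral_bigJumps (hν : IsLevyMeasure ν) {F : Type*}
    [NormedAddCommGroup F] [NormedSpace ℝ F] {f : E → F}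
    (hf : AEStronglyMeasurable f ν) {C : ℝ} (hC : ∀ u, ‖f u‖ ≤ C * min 1 (‖u‖ ^ 2)) :
    Tendsto (fun n => ∫ u, f u ∂(bigJumps ν n)) atTop (𝓝 (∫ u, f u ∂ν)) := by
  simp only [bigJumps]
  simp_rw [← integral_indicator (measurableSet_lt_norm _)]
  refine tendsto_integral_of_dominated_convergence (fun u => C * min 1 (‖u‖ ^ 2))
    (fun n => hf.indicator (measurableSet_lt_norm _)) (hν.integrable_min.const_mul C)
    (fun n => .of_forall fun u => (norm_indicator_le_norm_self _ _).trans (hC u))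
    (.of_forall fun u => ?_)
  -- The origin is never among the retained jumps, but the bound forces `f 0 = 0`; any other `u` is
  -- eventually retained.
  rcases eq_or_ne u 0 with rfl | hu
  · have : f 0 = 0 := by
      rw [← norm_le_zero_iff]
      simpa using hC 0
    simp [indicator, this]
  · refine tendsto_const_nhds.congr' ?_
    have hlim := tendsto_one_div_add_atTop_nhds_zero_nat (𝕜 := ℝ)
    filter_upwards [hlim.eventually (gt_mem_nhds (norm_pos_iff.2 hu))] with n hn
    rw [indicator_of_mem]
    exact hn

/-- The number of steps of the `n`-th random walk approximation. -/
noncomputable def numSteps (ν : Measure E) (n : ℕ) : ℕ :=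
  ⌈((n : ℝ) + 1) * (1 + (bigJumps ν n).real univ) ^ 2⌉₊

omit [BorelSpace E] in
-- This size serves twice: the steps outnumber the mass of the jumps, so the weight of the null jump
-- is nonnegative, and the squared mass over the number of steps is $O(1/n)$, which the passage to
-- the limit needs.
theorem le_numSteps (ν : Measure E) (n : ℕ) :
    ((n : ℝ) + 1) * (1 + (bigJumps ν n).real univ) ^ 2 ≤ numSteps ν n := Nat.le_ceil _

omit [BorelSpace E] in
theorem mass_le_numSteps (ν : Measure E) (n : ℕ) :
    1 + (bigJumps ν n).real univ ≤ numSteps ν n := by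
  have h0 : 0 ≤ (bigJumps ν n).real univ := measureReal_nonneg
  have hn : (0 : ℝ) ≤ n := n.cast_nonneg
  refine le_trans ?_ (le_numSteps ν n)
  nlinarith [mul_nonneg hn (sq_nonneg (1 + (bigJumps ν n).real univ))]

omit [BorelSpace E] in
theorem one_le_numSteps (ν : Measure E) (n : ℕ) : 1 ≤ numSteps ν n := by
  have h0 : 0 ≤ (bigJumps ν n).real univ := measureReal_nonneg
  have h := mass_le_numSteps ν n
  exact_mod_cast (by linarith : (1 : ℝ) ≤ numSteps ν n)

/-- The law of one step of the `n`-th random walk approximation, restricted to the jumps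
in `S`. -/
noncomputable def stepLaw (ν : Measure E) (n : ℕ) (S : Set E) : Measure E :=
  ENNReal.ofReal (1 - (numSteps ν n : ℝ)⁻¹ * (bigJumps ν n).real univ) • Measure.dirac 0 +
    ENNReal.ofReal (numSteps ν n : ℝ)⁻¹ • (bigJumps ν n).restrict S

theorem IsLevyMeasure.isFiniteMeasure_stepLaw (hν : IsLevyMeasure ν) (n : ℕ) (S : Set E) :
    IsFiniteMeasure (stepLaw ν n S) := by
  have := hν.isFiniteMeasure_bigJumps n
  rw [stepLaw]
  have h1 : IsFiniteMeasure (ENNReal.ofReal (1 - (numSteps ν n : ℝ)⁻¹ * (bigJumps ν n).real univ) •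
      (Measure.dirac 0 : Measure E)) := Measure.smul_finite _ ENNReal.ofReal_ne_top
  have h2 : IsFiniteMeasure (ENNReal.ofReal (numSteps ν n : ℝ)⁻¹ • (bigJumps ν n).restrict S) :=
    Measure.smul_finite _ ENNReal.ofReal_ne_top
  infer_instance

omit [BorelSpace E] in
-- The weight at `0` does not depend on `S`: jumps outside `S` are killed, not replaced by null
-- jumps, so the law is a sub-probability dominated by the full one.
theorem stepLaw_mono (ν : Measure E) (n : ℕ) (S : Set E) : stepLaw ν n S ≤ stepLaw ν n univ := by
  unfold stepLaw
  gcongr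
  exact subset_univ S

omit [BorelSpace E] in
theorem inv_numSteps_mul_mass_le_one (ν : Measure E) (n : ℕ) :
    (numSteps ν n : ℝ)⁻¹ * (bigJumps ν n).real univ ≤ 1 := by
  have h0 : (0 : ℝ) < numSteps ν n := by exact_mod_cast one_le_numSteps ν n
  rw [inv_mul_le_iff₀ h0]
  linarith [mass_le_numSteps ν n]

theorem IsLevyMeasure.isProbabilityMeasure_stepLaw (hν : IsLevyMeasure ν) (n : ℕ) :
    IsProbabilityMeasure (stepLaw ν n univ) := by
  have := hν.isFiniteMeasure_bigJumps n
  constructor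
  have h1 : ENNReal.ofReal ((bigJumps ν n).real univ) = bigJumps ν n univ := by simp
  rw [stepLaw, Measure.restrict_univ, Measure.add_apply, Measure.smul_apply, Measure.smul_apply,
    ← h1]
  simp only [measure_univ, smul_eq_mul, mul_one]
  rw [← ENNReal.ofReal_mul (by positivity), ← ENNReal.ofReal_add]
  · simp
  · linarith [inv_numSteps_mul_mass_le_one ν n]
  · positivity

omit [BorelSpace E] in
theorem integral_stepLaw (n : ℕ) {S : Set E}
    {F : Type*} [NormedAddCommGroup F] [NormedSpace ℝ F] [CompleteSpace F] {f : E → F}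
    (hf : StronglyMeasurable f) (hi : IntegrableOn f S (bigJumps ν n)) :
    Integrable f (stepLaw ν n S) ∧
    ∫ u, f u ∂(stepLaw ν n S) =
      (1 - (numSteps ν n : ℝ)⁻¹ * (bigJumps ν n).real univ) • f 0 +
        (numSteps ν n : ℝ)⁻¹ • ∫ u in S, f u ∂(bigJumps ν n) := by
  have h1 : Integrable f
      (ENNReal.ofReal (1 - (numSteps ν n : ℝ)⁻¹ * (bigJumps ν n).real univ) •
        Measure.dirac (0 : E)) :=
    (integrable_dirac' hf (by simp)).smul_measure ENNReal.ofReal_ne_top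
  have h2 : Integrable f (ENNReal.ofReal (numSteps ν n : ℝ)⁻¹ • (bigJumps ν n).restrict S) :=
    Integrable.smul_measure hi ENNReal.ofReal_ne_top
  refine ⟨h1.add_measure h2, ?_⟩
  rw [stepLaw, integral_add_measure h1 h2, integral_smul_measure, integral_smul_measure,
    integral_dirac' _ _ hf, ENNReal.toReal_ofReal, ENNReal.toReal_ofReal (by positivity)]
  linarith [inv_numSteps_mul_mass_le_one ν n]

end LevyMeasure

/-! ### Exponential transforms of the walks and their limits. -/

section RandomWalk

variable {E : Type*} [NormedAddCommGroup E] [InnerProductSpace ℝ E] [MeasurableSpace E]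
  [BorelSpace E] [FiniteDimensional ℝ E] {ν : Measure E}

/-- The drift of the `n`-th random walk approximation. -/
noncomputable def walkDrift (γ : E) (ν : Measure E) (n : ℕ) : E :=
  γ - ∫ u in Metric.closedBall 0 1, u ∂(bigJumps ν n)

theorem norm_compensated_exp_le {w : ℂ} {K r : ℝ} (hr : 0 ≤ r) (hr1 : r ≤ 1)
    (hw : ‖w‖ ≤ K * r) : ‖Complex.exp w - 1 - w‖ ≤ K ^ 2 * Real.exp K * min 1 (r ^ 2) := by
  have h := Complex.norm_exp_sub_sum_le_norm_mul_exp w 2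
  simp only [Finset.sum_range_succ, Finset.sum_range_zero, pow_zero, Nat.factorial, zero_add,
    pow_one, Nat.cast_one, div_one, mul_one] at h
  rw [← sub_sub] at h
  have hK : ‖w‖ ≤ |K| := hw.trans ((mul_le_mul_of_nonneg_right (le_abs_self K) hr).trans
    (mul_le_of_le_one_right (abs_nonneg K) hr1))
  have hK0 : 0 ≤ K * r := (norm_nonneg w).trans hw
  rw [min_eq_right (by nlinarith)]
  -- `K` can be negative when `r = 0`, so this case is treated apart.
  rcases eq_or_lt_of_le hr with h0 | h0
  · rw [← h0, mul_zero] at hw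
    rw [norm_le_zero_iff.1 hw]
    simp [← h0]
  · have hKn : 0 ≤ K := nonneg_of_mul_nonneg_left hK0 h0
    rw [abs_of_nonneg hKn] at hK
    calc _ ≤ ‖w‖ ^ 2 * Real.exp ‖w‖ := h
      _ ≤ (K * r) ^ 2 * Real.exp K := by gcongr
      _ = _ := by ring

omit [MeasurableSpace E] [BorelSpace E] [FiniteDimensional ℝ E] in
-- Small jumps are controlled by the second-order Taylor remainder, large ones by `C + 1`. A general
-- `c` covers both characteristic functions (`c = I`, `S = univ`) and Laplace transforms with
-- suppressed jumps (`c = 1`, `S` a ball).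
theorem norm_truncated_exponent_le {c : ℂ} {v : E} {S : Set E} (hS : ∀ u, ‖u‖ ≤ 1 → u ∈ S)
    {C : ℝ} (hC : ∀ u ∈ S, ‖Complex.exp (c * (inner ℝ v u : ℝ))‖ ≤ C) (u : E) :
    ‖S.indicator (fun u => Complex.exp (c * (inner ℝ v u : ℝ))) u - 1 -
      c * (inner ℝ v u : ℝ) * (if ‖u‖ ≤ 1 then 1 else 0)‖ ≤
      (C + 1 + (‖c‖ * ‖v‖) ^ 2 * Real.exp (‖c‖ * ‖v‖)) * min 1 (‖u‖ ^ 2) := by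
  have hC0 : 0 ≤ C := (norm_nonneg _).trans (hC 0 (hS 0 (by simp)))
  by_cases hu : ‖u‖ ≤ 1
  · rw [if_pos hu, indicator_of_mem (hS u hu), mul_one]
    have hw : ‖c * ((inner ℝ v u : ℝ) : ℂ)‖ ≤ ‖c‖ * ‖v‖ * ‖u‖ := by
      rw [norm_mul, Complex.norm_real, mul_assoc]
      gcongr
      exact norm_inner_le_norm v u
    refine (norm_compensated_exp_le (norm_nonneg u) hu hw).trans ?_
    gcongr
    linarith
  · rw [if_neg hu, mul_zero, sub_zero]
    have h1 : 1 ≤ ‖u‖ ^ 2 := by nlinarith [not_le.1 hu]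
    rw [min_eq_left h1, mul_one]
    have h2 : ‖S.indicator (fun u => Complex.exp (c * (inner ℝ v u : ℝ))) u‖ ≤ C := by
      by_cases hs : u ∈ S
      · rw [indicator_of_mem hs]; exact hC u hs
      · rw [indicator_of_notMem hs]; simpa using hC0
    calc _ ≤ ‖S.indicator (fun u => Complex.exp (c * (inner ℝ v u : ℝ))) u‖ + ‖(1 : ℂ)‖ :=
          norm_sub_le _ _
      _ ≤ C + 1 := by rw [norm_one]; linarith
      _ ≤ _ := le_add_of_nonneg_right (by positivity)

/-- Convergence of the exponential transforms of the random walk approximations. -/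
theorem IsLevyMeasure.tendsto_exp_mul_integral_stepLaw_pow (hν : IsLevyMeasure ν) (γ : E)
    {c : ℂ} {v : E} {S : Set E} (hSm : MeasurableSet S) (hS : ∀ u, ‖u‖ ≤ 1 → u ∈ S)
    {C : ℝ} (hC : ∀ u ∈ S, ‖Complex.exp (c * (inner ℝ v u : ℝ))‖ ≤ C) :
    Tendsto (fun n => Complex.exp (c * (inner ℝ v (walkDrift γ ν n) : ℝ)) *
      (∫ u, Complex.exp (c * (inner ℝ v u : ℝ)) ∂(stepLaw ν n S)) ^ numSteps ν n) atTop
      (𝓝 (Complex.exp (c * (inner ℝ v γ : ℝ) +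
        ∫ u, (S.indicator (fun u => Complex.exp (c * (inner ℝ v u : ℝ))) u - 1 -
          c * (inner ℝ v u : ℝ) * (if ‖u‖ ≤ 1 then 1 else 0)) ∂ν))) := by
  set χ : E → ℂ := fun u => Complex.exp (c * (inner ℝ v u : ℝ)) with hχ
  have hχm : Measurable χ := by fun_prop
  have hfin : ∀ n, IsFiniteMeasure (bigJumps ν n) := fun n => hν.isFiniteMeasure_bigJumps n
  have hC0 : 0 ≤ C := (norm_nonneg _).trans (hC 0 (hS 0 (by simp)))
  have hindb : ∀ u, ‖S.indicator χ u‖ ≤ C := fun u => by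
    by_cases hs : u ∈ S
    · rw [indicator_of_mem hs]; exact hC u hs
    · rw [indicator_of_notMem hs]; simpa using hC0
  have hindi : ∀ n, Integrable (S.indicator χ) (bigJumps ν n) := fun n =>
    Integrable.of_bound (hχm.indicator hSm).aestronglyMeasurable C (.of_forall hindb)
  set z : ℕ → ℂ := fun n => ∫ u, (S.indicator χ u - 1) ∂(bigJumps ν n) with hz
  have hzeq : ∀ n, z n = ∫ u, S.indicator χ u ∂(bigJumps ν n) - ((bigJumps ν n).real univ : ℂ) :=
    fun n => by
      rw [hz]
      dsimp only
      rw [integral_sub (hindi n) (integrable_const _), integral_const]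
      simp
  have hNpos : ∀ n, (0 : ℝ) < numSteps ν n := fun n => by exact_mod_cast one_le_numSteps ν n
  have hint : ∀ n, ∫ u, χ u ∂(stepLaw ν n S) = 1 + z n / numSteps ν n := fun n => by
    have h1 : IntegrableOn χ S (bigJumps ν n) := (integrable_indicator_iff hSm).1 (hindi n)
    have hNc : (numSteps ν n : ℂ) ≠ 0 := by exact_mod_cast (hNpos n).ne'
    rw [(integral_stepLaw n hχm.stronglyMeasurable h1).2, hzeq, integral_indicator hSm]
    simp only [hχ, inner_zero_right, Complex.ofReal_zero, mul_zero, Complex.exp_zero,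
      Complex.real_smul]
    push_cast
    field_simp
    ring
  have hznorm : ∀ n, ‖z n‖ ≤ (C + 1) * (bigJumps ν n).real univ := fun n => by
    refine norm_integral_le_of_norm_le_const (.of_forall fun u => ?_)
    calc _ ≤ ‖S.indicator χ u‖ + ‖(1 : ℂ)‖ := norm_sub_le _ _
      _ ≤ C + 1 := by rw [norm_one]; linarith [hindb u]
  have hzlim : Tendsto (fun n => ‖z n‖ ^ 2 / numSteps ν n) atTop (𝓝 0) := by
    have h0 : Tendsto (fun n : ℕ => (C + 1) ^ 2 * (1 / ((n : ℝ) + 1))) atTop (𝓝 0) := by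
      simpa using (tendsto_one_div_add_atTop_nhds_zero_nat (𝕜 := ℝ)).const_mul ((C + 1) ^ 2)
    refine squeeze_zero (fun n => by positivity) (fun n => ?_) h0
    have hm : 0 ≤ (bigJumps ν n).real univ := measureReal_nonneg
    have hn : (0 : ℝ) < n + 1 := by positivity
    rw [mul_one_div, div_le_div_iff₀ (hNpos n) hn]
    calc ‖z n‖ ^ 2 * (n + 1) ≤ ((C + 1) * (1 + (bigJumps ν n).real univ)) ^ 2 * (n + 1) := by
          gcongr
          refine (hznorm n).trans ?_
          gcongr
          linarith
      _ = (C + 1) ^ 2 * ((n + 1) * (1 + (bigJumps ν n).real univ) ^ 2) := by ring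
      _ ≤ _ := by gcongr; exact le_numSteps ν n
  have hpow := tendsto_one_add_div_pow_mul_exp_neg (one_le_numSteps ν) hzlim
  have hmeas : Measurable (fun u : E => S.indicator χ u - 1 -
      c * ((inner ℝ v u : ℝ) : ℂ) * (if ‖u‖ ≤ 1 then 1 else 0)) := by
    have h1 : Measurable (S.indicator χ) := hχm.indicator hSm
    have h2 : Measurable fun u : E => (if ‖u‖ ≤ 1 then (1 : ℂ) else 0) :=
      Measurable.ite (measurableSet_le measurable_norm measurable_const) measurable_const
        measurable_const
    fun_prop
  have hmain := hν.tendsto_integral_bigJumps hmeas.aestronglyMeasurable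
    (norm_truncated_exponent_le hS hC)
  have hball : ∀ n, IntegrableOn (fun u : E => u) (Metric.closedBall 0 1) (bigJumps ν n) := by
    intro n
    refine Measure.integrableOn_of_bounded (M := 1) (measure_ne_top _ _)
      measurable_id.aestronglyMeasurable ?_
    refine (ae_restrict_iff' measurableSet_closedBall).2 (.of_forall fun u hu => ?_)
    simpa using hu
  -- The walk's drift subtracts the mean of the retained jumps of norm at most `1`, which is exactly
  -- the compensator in the Lévy–Khintchine integrand.
  have hdrift : ∀ n, c * ((inner ℝ v (walkDrift γ ν n) : ℝ) : ℂ) + z n =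
      c * (inner ℝ v γ : ℝ) + ∫ u, (S.indicator χ u - 1 -
        c * (inner ℝ v u : ℝ) * (if ‖u‖ ≤ 1 then 1 else 0)) ∂(bigJumps ν n) := by
    intro n
    have hif : (fun u : E => c * ((inner ℝ v u : ℝ) : ℂ) * (if ‖u‖ ≤ 1 then (1 : ℂ) else 0)) =
        (Metric.closedBall (0 : E) 1).indicator fun u => c * ((inner ℝ v u : ℝ) : ℂ) := by
      ext u
      by_cases hu : ‖u‖ ≤ 1 <;> simp [indicator, hu]
    have hi1 : IntegrableOn (fun u : E => c * ((inner ℝ v u : ℝ) : ℂ)) (Metric.closedBall 0 1)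
        (bigJumps ν n) := ((hball n).const_inner v).ofReal.const_mul c
    have hi2 : Integrable (fun u : E => c * ((inner ℝ v u : ℝ) : ℂ) *
        (if ‖u‖ ≤ 1 then (1 : ℂ) else 0)) (bigJumps ν n) := by
      rw [hif]
      exact (integrable_indicator_iff measurableSet_closedBall).2 hi1
    have hin : ∫ u, c * ((inner ℝ v u : ℝ) : ℂ) * (if ‖u‖ ≤ 1 then (1 : ℂ) else 0) ∂(bigJumps ν n)
        = c * ((inner ℝ v (∫ u in Metric.closedBall 0 1, u ∂(bigJumps ν n)) : ℝ) : ℂ) := by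
      rw [hif, integral_indicator measurableSet_closedBall, integral_const_mul,
        integral_complex_ofReal, integral_inner (hball n)]
    rw [integral_sub (f := fun u => S.indicator χ u - 1) ((hindi n).sub (integrable_const _)) hi2,
      hin, walkDrift, inner_sub_right]
    dsimp only [z]
    push_cast
    ring
  have hexp := (Complex.continuous_exp.tendsto _).comp
    (hmain.const_add (c * ((inner ℝ v γ : ℝ) : ℂ)))
  have hprod := hexp.mul hpow
  rw [mul_one] at hprod
  refine hprod.congr fun n => ?_
  rw [Function.comp_apply, ← hdrift n, Complex.exp_add, hint n]
  calc _ = Complex.exp (c * ((inner ℝ v (walkDrift γ ν n) : ℝ) : ℂ)) *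
        (1 + z n / numSteps ν n) ^ numSteps ν n * (Complex.exp (z n) * Complex.exp (-z n)) := by ring
    _ = _ := by rw [← Complex.exp_add, add_neg_cancel, Complex.exp_zero, mul_one]

omit [MeasurableSpace E] [BorelSpace E] [FiniteDimensional ℝ E] in
theorem exp_mul_inner_add (c : ℂ) (v x y : E) :
    Complex.exp (c * (inner ℝ v (x + y) : ℝ)) =
      Complex.exp (c * (inner ℝ v x : ℝ)) * Complex.exp (c * (inner ℝ v y : ℝ)) := by
  rw [inner_add_right, Complex.ofReal_add, mul_add, Complex.exp_add]

/-- The law of the `n`-th random walk approximation. -/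
noncomputable def walkLaw (γ : E) (ν : Measure E) (n : ℕ) : Measure E :=
  (convPow (stepLaw ν n univ) (numSteps ν n)).map (· + walkDrift γ ν n)

theorem IsLevyMeasure.isProbabilityMeasure_walkLaw (hν : IsLevyMeasure ν) (γ : E) (n : ℕ) :
    IsProbabilityMeasure (walkLaw γ ν n) := by
  have := hν.isProbabilityMeasure_stepLaw n
  exact Measure.isProbabilityMeasure_map (by fun_prop)

theorem IsLevyMeasure.tendsto_charFun_walkLaw (hν : IsLevyMeasure ν) (γ t : E) :
    Tendsto (fun n => charFun (walkLaw γ ν n) t) atTop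
      (𝓝 (Complex.exp (Complex.I * ((inner ℝ t γ : ℝ) : ℂ) +
        ∫ u, (Complex.exp (Complex.I * ((inner ℝ t u : ℝ) : ℂ)) - 1 -
          Complex.I * ((inner ℝ t u : ℝ) : ℂ) * (if ‖u‖ ≤ 1 then 1 else 0)) ∂ν))) := by
  have hb : ∀ u : E, ‖Complex.exp (Complex.I * ((inner ℝ t u : ℝ) : ℂ))‖ ≤ 1 := fun u =>
    (Complex.norm_exp_I_mul_ofReal _).le
  have h := hν.tendsto_exp_mul_integral_stepLaw_pow γ (c := Complex.I) (v := t)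
    MeasurableSet.univ (fun _ _ => mem_univ _) (fun u _ => hb u)
  simp only [indicator_univ] at h
  refine h.congr fun n => ?_
  have := hν.isProbabilityMeasure_stepLaw n
  have hm : Measurable fun u : E => Complex.exp (Complex.I * ((inner ℝ t u : ℝ) : ℂ)) := by
    fun_prop
  rw [walkLaw, charFun_apply, integral_map (by fun_prop) (by fun_prop)]
  have h2 := integral_convPow_of_mul (χ := fun u : E =>
    Complex.exp (Complex.I * ((inner ℝ t u : ℝ) : ℂ))) (by simp)
    (exp_mul_inner_add Complex.I t) hm (stepLaw ν n univ)
    (Integrable.of_bound hm.aestronglyMeasurable 1 (.of_forall hb)) (numSteps ν n)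
  rw [← h2.2, ← integral_const_mul]
  congr 1
  ext x
  rw [mul_comm, ← exp_mul_inner_add, real_inner_comm, mul_comm]

end RandomWalk

/-! ### Passage from the walks to the infinitely divisible vector. -/

section RandomWalkLimit

variable {Ω : Type*} [MeasurableSpace Ω] {P : Measure Ω} [IsProbabilityMeasure P] {d : ℕ}
  {X : Ω → EuclideanSpace ℝ (Fin d)} {γ : EuclideanSpace ℝ (Fin d)}
  {ν : Measure (EuclideanSpace ℝ (Fin d))}

/-- The random walk approximations converge in law to `X`. -/
theorem IsID.tendsto_integral_walkLaw (hX : IsID P X γ ν) {f : EuclideanSpace ℝ (Fin d) → ℝ}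
    (hf : Continuous f) {B : ℝ} (hB : ∀ x, |f x| ≤ B) :
    Tendsto (fun n => ∫ x, f x ∂(walkLaw γ ν n)) atTop (𝓝 (∫ ω, f (X ω) ∂P)) := by
  have hp := hX.isLevyMeasure.isProbabilityMeasure_walkLaw γ
  have hPX : IsProbabilityMeasure (P.map X) :=
    Measure.isProbabilityMeasure_map hX.measurable.aemeasurable
  let μ : ℕ → ProbabilityMeasure (EuclideanSpace ℝ (Fin d)) := fun n => ⟨walkLaw γ ν n, hp n⟩
  let μ₀ : ProbabilityMeasure (EuclideanSpace ℝ (Fin d)) := ⟨P.map X, hPX⟩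
  have hlim : Tendsto μ atTop (𝓝 μ₀) := by
    refine ProbabilityMeasure.tendsto_iff_tendsto_charFun.2 fun t => ?_
    have h0 : charFun (P.map X) t = Complex.exp (levyExponent γ ν t) := by
      rw [← hX.charFun_eq t, charFun_apply,
        integral_map hX.measurable.aemeasurable (by fun_prop)]
      congr 1
      ext ω
      rw [mul_comm, real_inner_comm]
    change Tendsto (fun n => charFun (walkLaw γ ν n) t) atTop (𝓝 (charFun (P.map X) t))
    rw [h0]
    exact hX.isLevyMeasure.tendsto_charFun_walkLaw γ t
  have h := ProbabilityMeasure.tendsto_iff_forall_integral_tendsto.1 hlim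
    (BoundedContinuousFunction.ofNormedAddCommGroup f hf B hB)
  have h2 : ∫ x, f x ∂(P.map X) = ∫ ω, f (X ω) ∂P :=
    integral_map hX.measurable.aemeasurable hf.measurable.aestronglyMeasurable
  rw [← h2]
  exact h

/-- Exponential moment bound for a function of an infinitely divisible vector, in terms of a
uniform bound on the integral of `e^Δ - 1 - Δ` over its increments `Δ`. -/
theorem IsID.integral_exp_le (hX : IsID P X γ ν) {F : EuclideanSpace ℝ (Fin d) → ℝ}
    (hF : Continuous F) {B : ℝ} (hB : ∀ x, |F x| ≤ B) {κ : ℝ}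
    (hκ : ∀ x, Integrable (fun u => Real.exp (F (x + u) - F x) - 1 - (F (x + u) - F x)) ν ∧
      ∫ u, (Real.exp (F (x + u) - F x) - 1 - (F (x + u) - F x)) ∂ν ≤ κ) :
    ∫ ω, Real.exp (F (X ω)) ∂P ≤ Real.exp (κ + ∫ ω, F (X ω) ∂P) := by
  have hν := hX.isLevyMeasure
  have heb : ∀ x, |Real.exp (F x)| ≤ Real.exp B := fun x => by
    rw [abs_of_pos (Real.exp_pos _)]
    exact Real.exp_le_exp.2 ((le_abs_self _).trans (hB x))
  refine le_of_tendsto_of_tendsto'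
    (hX.tendsto_integral_walkLaw (f := fun x => Real.exp (F x)) (by fun_prop) heb)
    ((Real.continuous_exp.tendsto _).comp ((hX.tendsto_integral_walkLaw hF hB).const_add κ))
    fun n => ?_
  have hp := hν.isProbabilityMeasure_stepLaw n
  have hNpos : (0 : ℝ) < numSteps ν n := by exact_mod_cast one_le_numSteps ν n
  have hFm := hF.measurable
  have hstep : ∀ x, ∫ u, (Real.exp (F (x + u) - F x) - 1 - (F (x + u) - F x))
      ∂(stepLaw ν n univ) ≤ (numSteps ν n : ℝ)⁻¹ * κ := by
    intro x
    have hm : StronglyMeasurable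
        fun u => Real.exp (F (x + u) - F x) - 1 - (F (x + u) - F x) :=
      -- The integrand vanishes at the null jump, so a single step contributes at most `κ` divided
      -- by the number of steps.
      (by fun_prop : Measurable _).stronglyMeasurable
    rw [(integral_stepLaw n hm (hκ x).1.restrict.restrict).2, add_zero, sub_self, Real.exp_zero,
      sub_self, sub_self, smul_zero, zero_add, smul_eq_mul, Measure.restrict_univ]
    gcongr
    exact (setIntegral_le_integral (hκ x).1
      (.of_forall fun u => exp_sub_one_sub_nonneg _)).trans (hκ x).2
  have h := integral_exp_convPow_le (stepLaw ν n univ) (numSteps ν n)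
    (F := fun x => F (x + walkDrift γ ν n)) (by fun_prop) (fun x => hB _)
    (κ := (numSteps ν n : ℝ)⁻¹ * κ) (fun x => by
      simpa only [add_right_comm x _ (walkDrift γ ν n)] using hstep (x + walkDrift γ ν n))
  rw [Function.comp_apply, walkLaw, integral_map (by fun_prop) (by fun_prop),
    integral_map (by fun_prop) (by fun_prop)]
  rwa [mul_inv_cancel_left₀ hNpos.ne'] at h

theorem exp_inner_le_of_mem_closedBall (v : EuclideanSpace ℝ (Fin d)) (R : ℝ)
    (u : EuclideanSpace ℝ (Fin d)) (hu : u ∈ Metric.closedBall 0 R) :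
    Real.exp (inner ℝ v u) ≤ Real.exp (‖v‖ * R) := by
  refine Real.exp_le_exp.2 ((real_inner_le_norm v u).trans ?_)
  gcongr
  simpa using hu

/-- The exponent of the Laplace transform at `v` of the law with drift `γ` and Lévy measure `ν`
when the jumps of size larger than `R` are suppressed. -/
noncomputable def truncatedLaplaceExponent (γ : EuclideanSpace ℝ (Fin d))
    (ν : Measure (EuclideanSpace ℝ (Fin d))) (R : ℝ) (v : EuclideanSpace ℝ (Fin d)) : ℝ :=
  inner ℝ v γ + ∫ u, ((Metric.closedBall 0 R).indicator (fun u => Real.exp (inner ℝ v u)) u - 1 -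
    inner ℝ v u * (if ‖u‖ ≤ 1 then 1 else 0)) ∂ν

theorem ofReal_truncated_exponent (R : ℝ) (v u : EuclideanSpace ℝ (Fin d)) :
    (((Metric.closedBall 0 R).indicator (fun u => Real.exp (inner ℝ v u)) u - 1 -
      inner ℝ v u * (if ‖u‖ ≤ 1 then 1 else 0) : ℝ) : ℂ) =
    (Metric.closedBall 0 R).indicator (fun u => Complex.exp (1 * ((inner ℝ v u : ℝ) : ℂ))) u - 1 -
      1 * ((inner ℝ v u : ℝ) : ℂ) * (if ‖u‖ ≤ 1 then 1 else 0) := by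
  by_cases h1 : u ∈ Metric.closedBall (0 : EuclideanSpace ℝ (Fin d)) R <;>
    by_cases h2 : ‖u‖ ≤ 1 <;> simp [indicator, h1, h2]

theorem IsLevyMeasure.integral_exp_inner_convPow (hν : IsLevyMeasure ν)
    (v : EuclideanSpace ℝ (Fin d)) (R : ℝ) (n : ℕ) :
    Integrable (fun x => Real.exp (inner ℝ v x))
      (convPow (stepLaw ν n (Metric.closedBall 0 R)) (numSteps ν n)) ∧
    ((∫ x, Real.exp (inner ℝ v x)
      ∂(convPow (stepLaw ν n (Metric.closedBall 0 R)) (numSteps ν n)) : ℝ) : ℂ) =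
      (∫ u, Complex.exp (1 * (inner ℝ v u : ℝ)) ∂(stepLaw ν n (Metric.closedBall 0 R))) ^
        numSteps ν n := by
  have hfin := hν.isFiniteMeasure_bigJumps n
  have hfin' := hν.isFiniteMeasure_stepLaw n (Metric.closedBall 0 R)
  have hm : Measurable fun u : EuclideanSpace ℝ (Fin d) =>
    Complex.exp (1 * ((inner ℝ v u : ℝ) : ℂ)) := by fun_prop
  have hnorm : ∀ u : EuclideanSpace ℝ (Fin d),
      ‖Complex.exp (1 * ((inner ℝ v u : ℝ) : ℂ))‖ = Real.exp (inner ℝ v u) := fun u => by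
    rw [one_mul, Complex.norm_exp_ofReal]
  have hon : IntegrableOn (fun u => Complex.exp (1 * ((inner ℝ v u : ℝ) : ℂ)))
      (Metric.closedBall 0 R) (bigJumps ν n) := by
    refine Measure.integrableOn_of_bounded (M := Real.exp (‖v‖ * R)) (measure_ne_top _ _)
      hm.aestronglyMeasurable ?_
    refine (ae_restrict_iff' measurableSet_closedBall).2 (.of_forall fun u hu => ?_)
    rw [hnorm]
    exact exp_inner_le_of_mem_closedBall v R u hu
  have h := integral_convPow_of_mul (χ := fun u : EuclideanSpace ℝ (Fin d) =>
    Complex.exp (1 * ((inner ℝ v u : ℝ) : ℂ))) (by simp) (exp_mul_inner_add 1 v) hm _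
    (integral_stepLaw n hm.stronglyMeasurable hon).1 (numSteps ν n)
  refine ⟨?_, ?_⟩
  · simpa only [hnorm] using h.1.norm
  · rw [← h.2, ← integral_complex_ofReal]
    congr 1
    ext u
    rw [one_mul, Complex.ofReal_exp]

theorem IsLevyMeasure.tendsto_integral_exp_inner_convPow (hν : IsLevyMeasure ν)
    (v : EuclideanSpace ℝ (Fin d)) {R : ℝ} (hR : 1 ≤ R) :
    Tendsto (fun n => ∫ x, Real.exp (inner ℝ v (x + walkDrift γ ν n))
      ∂(convPow (stepLaw ν n (Metric.closedBall 0 R)) (numSteps ν n))) atTop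
      (𝓝 (Real.exp (truncatedLaplaceExponent γ ν R v))) := by
  have h := hν.tendsto_exp_mul_integral_stepLaw_pow γ (c := 1) (v := v)
    (S := Metric.closedBall 0 R) measurableSet_closedBall
    (fun u hu => by simpa using hu.trans hR) (C := Real.exp (‖v‖ * R)) (fun u hu => by
      rw [one_mul, Complex.norm_exp_ofReal]
      exact exp_inner_le_of_mem_closedBall v R u hu)
  simp only [← ofReal_truncated_exponent] at h
  rw [integral_complex_ofReal, one_mul, ← Complex.ofReal_add, ← Complex.ofReal_exp] at h
  refine ((Complex.continuous_re.tendsto _).comp h).congr fun n => ?_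
  rw [Function.comp_apply, ← (hν.integral_exp_inner_convPow v R n).2, one_mul,
    ← Complex.ofReal_exp, ← Complex.ofReal_mul, Complex.ofReal_re, ← integral_const_mul]
  congr 1
  ext x
  rw [inner_add_right, Real.exp_add, mul_comm]

/-- A lower bound for the exponential moments of an infinitely divisible vector. -/
theorem IsID.exp_truncatedLaplaceExponent_le (hX : IsID P X γ ν)
    {v : EuclideanSpace ℝ (Fin d)} (hv : Integrable (fun ω => Real.exp (inner ℝ v (X ω))) P)
    {R : ℝ} (hR : 1 ≤ R) :
    Real.exp (truncatedLaplaceExponent γ ν R v) ≤ ∫ ω, Real.exp (inner ℝ v (X ω)) ∂P := by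
  have hν := hX.isLevyMeasure
  -- With $y=e^{\langle v,x\rangle}$, one has $\min(y,m)\ge y-y^2/m$. The left side is a bounded
  -- continuous test function, nonnegative, hence smaller under the walk with suppressed jumps; the
  -- right side involves only Laplace transforms of the latter at `v` and `2v`, whose limits are
  -- known. Then `m → ∞`.
  have key : ∀ m : ℝ, 0 < m → Real.exp (truncatedLaplaceExponent γ ν R v) -
      Real.exp (truncatedLaplaceExponent γ ν R ((2 : ℝ) • v)) * m⁻¹ ≤
      ∫ ω, Real.exp (inner ℝ v (X ω)) ∂P := by
    intro m hm
    have hb : ∀ x : EuclideanSpace ℝ (Fin d), |min (Real.exp (inner ℝ v x)) m| ≤ m := fun x => by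
      rw [abs_of_nonneg (le_min (Real.exp_pos _).le hm.le)]
      exact min_le_right _ _
    have hle : ∫ ω, min (Real.exp (inner ℝ v (X ω))) m ∂P ≤
        ∫ ω, Real.exp (inner ℝ v (X ω)) ∂P := by
      have hXm := hX.measurable
      exact integral_mono (integrable_of_measurable_of_abs_le (by fun_prop) fun ω => hb (X ω)) hv
        fun ω => min_le_left _ _
    refine le_trans ?_ hle
    refine le_of_tendsto_of_tendsto'
      ((hν.tendsto_integral_exp_inner_convPow (γ := γ) v hR).sub
        ((hν.tendsto_integral_exp_inner_convPow (γ := γ) ((2 : ℝ) • v) hR).mul_const m⁻¹))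
      (hX.tendsto_integral_walkLaw (f := fun x => min (Real.exp (inner ℝ v x)) m)
        (by fun_prop) hb) fun n => ?_
    have hp := hν.isProbabilityMeasure_stepLaw n
    have hfin' := hν.isFiniteMeasure_stepLaw n (Metric.closedBall 0 R)
    have hsh : ∀ w : EuclideanSpace ℝ (Fin d), Integrable
        (fun x => Real.exp (inner ℝ w (x + walkDrift γ ν n)))
        (convPow (stepLaw ν n (Metric.closedBall 0 R)) (numSteps ν n)) := fun w => by
      simp only [inner_add_right, Real.exp_add]
      exact (hν.integral_exp_inner_convPow w R n).1.mul_const _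
    rw [walkLaw, integral_map (by fun_prop) (by fun_prop), ← integral_mul_const,
      ← integral_sub (hsh _) ((hsh _).mul_const _)]
    calc _ ≤ ∫ x, min (Real.exp (inner ℝ v (x + walkDrift γ ν n))) m
          ∂(convPow (stepLaw ν n (Metric.closedBall 0 R)) (numSteps ν n)) := by
          refine integral_mono ((hsh _).sub ((hsh _).mul_const _))
            (integrable_of_measurable_of_abs_le (by fun_prop) fun x => hb _) fun x => ?_
          have h2 : Real.exp (inner ℝ ((2 : ℝ) • v) (x + walkDrift γ ν n)) =
              Real.exp (inner ℝ v (x + walkDrift γ ν n)) ^ 2 := by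
            rw [real_inner_smul_left, ← Real.exp_nat_mul]; norm_num
          simp only [h2]
          set y := Real.exp (inner ℝ v (x + walkDrift γ ν n)) with hy
          have hy0 : 0 < y := Real.exp_pos _
          have h3 : 0 ≤ y ^ 2 * m⁻¹ := by positivity
          refine le_min (by linarith) ?_
          have h4 : y ^ 2 * m⁻¹ * m = y ^ 2 := by field_simp
          nlinarith [sq_nonneg (y - m)]
      _ ≤ _ := by
          refine integral_mono_measure (convPow_mono (stepLaw_mono ν n _) _)
            (.of_forall fun x => le_min (Real.exp_pos _).le hm.le) ?_
          exact integrable_of_measurable_of_abs_le (by fun_prop) fun x => hb _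
  have hlim : Tendsto (fun m : ℝ => Real.exp (truncatedLaplaceExponent γ ν R v) -
      Real.exp (truncatedLaplaceExponent γ ν R ((2 : ℝ) • v)) * m⁻¹) atTop
      (𝓝 (Real.exp (truncatedLaplaceExponent γ ν R v))) := by
    simpa using (tendsto_inv_atTop_zero (𝕜 := ℝ)).const_mul
      (Real.exp (truncatedLaplaceExponent γ ν R ((2 : ℝ) • v))) |>.const_sub
      (Real.exp (truncatedLaplaceExponent γ ν R v))
  exact le_of_tendsto hlim ((eventually_gt_atTop 0).mono key)

/-- Exponential moments of an infinitely divisible vector are inherited by the large jumps of its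
Lévy measure. -/
theorem IsID.integrableOn_exp_inner (hX : IsID P X γ ν)
    {v : EuclideanSpace ℝ (Fin d)} (hv : Integrable (fun ω => Real.exp (inner ℝ v (X ω))) P) :
    IntegrableOn (fun u => Real.exp (inner ℝ v u)) {u | 1 < ‖u‖} ν := by
  have hν := hX.isLevyMeasure
  have hfin : ν {u | 1 < ‖u‖} < ⊤ := hν.measure_lt_norm_lt_top one_pos
  have hT := measurableSet_lt_norm (E := EuclideanSpace ℝ (Fin d)) 1
  have hcov : AECover (ν.restrict {u | 1 < ‖u‖}) atTop
      fun n : ℕ => Metric.closedBall (0 : EuclideanSpace ℝ (Fin d)) (n : ℝ) :=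
    aecover_closedBall tendsto_natCast_atTop_atTop
  have hon : ∀ R : ℝ, Integrable
      (({u | 1 < ‖u‖} ∩ Metric.closedBall 0 R).indicator fun u => Real.exp (inner ℝ v u)) ν := by
    intro R
    refine (integrable_indicator_iff (hT.inter measurableSet_closedBall)).2 ?_
    refine Measure.integrableOn_of_bounded (M := Real.exp (‖v‖ * R))
      (measure_ne_top_of_subset inter_subset_left hfin.ne) (by fun_prop) ?_
    refine (ae_restrict_iff' (hT.inter measurableSet_closedBall)).2 (.of_forall fun u hu => ?_)
    rw [Real.norm_of_nonneg (Real.exp_pos _).le]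
    exact exp_inner_le_of_mem_closedBall v R u hu.2
  refine hcov.integrable_of_integral_bounded_of_nonneg_ae
    (Real.log (∫ ω, Real.exp (inner ℝ v (X ω)) ∂P) - inner ℝ v γ + ν.real {u | 1 < ‖u‖})
    (fun n => ?_) (.of_forall fun u => (Real.exp_pos _).le) ?_
  · have h := hon n
    rw [integrable_indicator_iff (hT.inter measurableSet_closedBall)] at h
    rw [IntegrableOn, Measure.restrict_restrict measurableSet_closedBall, inter_comm]
    exact h
  · filter_upwards [eventually_ge_atTop 1] with n hn
    have hR : (1 : ℝ) ≤ n := by exact_mod_cast hn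
    have hle := (Real.le_log_iff_exp_le (lt_of_lt_of_le (Real.exp_pos _)
      (hX.exp_truncatedLaplaceExponent_le hv hR))).2 (hX.exp_truncatedLaplaceExponent_le hv hR)
    rw [truncatedLaplaceExponent] at hle
    have hgm : Measurable fun u : EuclideanSpace ℝ (Fin d) =>
        (Metric.closedBall 0 (n : ℝ)).indicator (fun u => Real.exp (inner ℝ v u)) u - 1 -
          inner ℝ v u * (if ‖u‖ ≤ 1 then 1 else 0) := by
      have h1 : Measurable ((Metric.closedBall (0 : EuclideanSpace ℝ (Fin d)) (n : ℝ)).indicator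
        fun u => Real.exp (inner ℝ v u)) :=
        (by fun_prop : Measurable fun u => Real.exp (inner ℝ v u)).indicator
          measurableSet_closedBall
      have h2 : Measurable fun u : EuclideanSpace ℝ (Fin d) => (if ‖u‖ ≤ 1 then (1 : ℝ) else 0) :=
        Measurable.ite (measurableSet_le measurable_norm measurable_const) measurable_const
          measurable_const
      fun_prop
    have hgi := hν.integrable_of_norm_le hgm.aestronglyMeasurable
      (C := Real.exp (‖v‖ * n) + 1 + (‖(1 : ℂ)‖ * ‖v‖) ^ 2 * Real.exp (‖(1 : ℂ)‖ * ‖v‖))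
      (fun u => by
        rw [← Complex.norm_real, ofReal_truncated_exponent]
        refine norm_truncated_exponent_le (fun u hu => by simpa using hu.trans hR)
          (fun u hu => ?_) u
        rw [one_mul, Complex.norm_exp_ofReal]
        exact exp_inner_le_of_mem_closedBall v n u hu)
    have hone : Integrable ({u : EuclideanSpace ℝ (Fin d) | 1 < ‖u‖}.indicator
        fun _ => (1 : ℝ)) ν := (integrable_indicator_iff hT).2 (integrableOn_const hfin.ne)
    -- On the unit ball the exponent's integrand is $e^y-1-y\ge0$; outside it there is no
    -- compensator. So the exponent controls the integral over $1<\|u\|\le n$ up to the finite mass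
    -- of the large jumps, uniformly in `n`.
    have hcmp := integral_mono ((hon n).sub hone) hgi (fun u => by
      simp only [Pi.sub_apply]
      by_cases h1 : ‖u‖ ≤ 1
      · have h2 : ¬ 1 < ‖u‖ := not_lt.2 h1
        have h3 : ‖u‖ ≤ n := h1.trans hR
        simp only [indicator, mem_inter_iff, mem_ofPred_eq, h2, false_and, if_false,
          mem_closedBall_zero_iff, h3, h1, if_true, mul_one]
        linarith [exp_sub_one_sub_nonneg (inner ℝ v u)]
      · have h2 : 1 < ‖u‖ := not_le.1 h1
        rw [indicator_of_mem (show u ∈ {u : EuclideanSpace ℝ (Fin d) | 1 < ‖u‖} from h2),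
          if_neg h1, mul_zero, sub_zero]
        exact sub_le_sub_right (indicator_le_indicator_of_subset inter_subset_right
          (fun _ => (Real.exp_pos _).le) u) 1)
    have hsplit := integral_sub (hon n) hone
    simp only [Pi.sub_apply] at hcmp
    rw [hsplit, integral_indicator (hT.inter measurableSet_closedBall), integral_indicator hT,
      setIntegral_const, smul_eq_mul, mul_one] at hcmp
    rw [Measure.restrict_restrict measurableSet_closedBall, inter_comm]
    linarith

end RandomWalkLimit

/-! ### Inverse of the rate and Legendre transform. -/

section InverseRate

/-- If `g` is monotone and is a subgradient of `Φ`, then its integral is at most the increment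
of `Φ`. -/
theorem integral_le_sub_of_subgradient {g Φ : ℝ → ℝ} {x : ℝ} (hx : 0 < x)
    (hg : MonotoneOn g (Icc 0 x))
    (hΦ : ∀ a ∈ Icc 0 x, ∀ b ∈ Icc 0 x, (b - a) * g a ≤ Φ b - Φ a) :
    ∫ s in (0 : ℝ)..x, g s ≤ Φ x - Φ 0 := by
  -- On each of `n + 1` equal cells, `g` is at most its right value, that is, its left value plus
  -- its increment. The left values are summed by the subgradient inequality and the increments
  -- telescope; no continuity of `g` is involved.
  have key : ∀ n : ℕ, ∫ s in (0 : ℝ)..x, g s ≤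
      Φ x - Φ 0 + x * (g x - g 0) * (1 / ((n : ℝ) + 1)) := by
    intro n
    have hn : (0 : ℝ) < n + 1 := by positivity
    set a : ℕ → ℝ := fun i => i * (x / (n + 1)) with ha
    have ha0 : a 0 = 0 := by simp [ha]
    have han : a (n + 1) = x := by simp only [ha]; push_cast; field_simp
    have hstep : ∀ i, a (i + 1) - a i = x / (n + 1) := fun i => by
      simp only [ha]; push_cast; ring
    have hxn : 0 < x / (n + 1) := by positivity
    have hmem : ∀ i, i ≤ n + 1 → a i ∈ Icc 0 x := fun i hi => by
      refine ⟨by positivity, ?_⟩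
      rw [← han]
      simp only [ha]
      gcongr
    have hsub : ∀ i < n + 1, Icc (a i) (a (i + 1)) ⊆ Icc 0 x := fun i hi =>
      Icc_subset_Icc (hmem i hi.le).1 (hmem (i + 1) hi).2
    have hle : ∀ i, a i ≤ a (i + 1) := fun i => by linarith [hstep i]
    have hint : ∀ i < n + 1, IntervalIntegrable g volume (a i) (a (i + 1)) := fun i hi => by
      refine MonotoneOn.intervalIntegrable ?_
      rw [uIcc_of_le (hle i)]
      exact hg.mono (hsub i hi)
    have hsum := intervalIntegral.sum_integral_adjacent_intervals hint
    rw [ha0, han] at hsum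
    rw [← hsum]
    have hΦs : Φ x - Φ 0 = ∑ i ∈ Finset.range (n + 1), (Φ (a (i + 1)) - Φ (a i)) := by
      rw [Finset.sum_range_sub (fun i => Φ (a i)), ha0, han]
    have hgs : g x - g 0 = ∑ i ∈ Finset.range (n + 1), (g (a (i + 1)) - g (a i)) := by
      rw [Finset.sum_range_sub (fun i => g (a i)), ha0, han]
    rw [hΦs, hgs, mul_one_div, mul_div_right_comm, Finset.mul_sum, ← Finset.sum_add_distrib]
    refine Finset.sum_le_sum fun i hi => ?_
    have hi' := Finset.mem_range.1 hi
    have h1 : ∫ s in a i..a (i + 1), g s ≤ ∫ _ in a i..a (i + 1), g (a (i + 1)) :=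
      intervalIntegral.integral_mono_on (hle i) (hint i hi') intervalIntegrable_const
        fun s hs => hg (hsub i hi' hs) (hmem (i + 1) hi') hs.2
    rw [intervalIntegral.integral_const, smul_eq_mul, hstep] at h1
    have h2 := hΦ (a i) (hmem i hi'.le) (a (i + 1)) (hmem (i + 1) hi')
    rw [hstep] at h2
    linarith
  have hlim := (tendsto_one_div_add_atTop_nhds_zero_nat (𝕜 := ℝ)).const_mul (x * (g x - g 0))
    |>.const_add (Φ x - Φ 0)
  rw [mul_zero, add_zero] at hlim
  exact ge_of_tendsto' hlim key

variable {M : EReal} {h K : ℝ → ℝ}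

theorem exists_gt_mem_Ico_ereal {t : ℝ} (ht : 0 ≤ t ∧ (t : EReal) < M) :
    ∃ t', t < t' ∧ 0 ≤ t' ∧ (t' : EReal) < M := by
  obtain ⟨t', h1, h2⟩ := EReal.lt_iff_exists_real_btwn.1 ht.2
  have h1' : t < t' := by exact_mod_cast h1
  exact ⟨t', h1', ht.1.trans h1'.le, h2⟩

/-- A continuous strictly increasing function on `[0, M)` vanishing at `0` is a bijection onto
`[0, L)`, where `L` is its left limit at `M`. -/
theorem exists_tendsto_and_bijOn (hM : 0 < M)
    (hmono : StrictMonoOn h {t : ℝ | 0 ≤ t ∧ (t : EReal) < M})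
    (hcont : ∀ b : ℝ, 0 ≤ b ∧ (b : EReal) < M → ContinuousOn h (Icc 0 b)) (h0 : h 0 = 0) :
    ∃ L : EReal,
      Tendsto (fun t : ℝ => (h t : EReal)) (comap (fun t : ℝ => (t : EReal)) (𝓝[<] M)) (𝓝 L) ∧
      BijOn h {t : ℝ | 0 ≤ t ∧ (t : EReal) < M} {s : ℝ | 0 ≤ s ∧ (s : EReal) < L} := by
  set D : Set ℝ := {t : ℝ | 0 ≤ t ∧ (t : EReal) < M} with hD
  have h0D : (0 : ℝ) ∈ D := ⟨le_rfl, by simpa using hM⟩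
  -- The supremum is not attained, as `h` is strictly increasing and $[0,M)$ has no largest element;
  -- hence the target is half-open.
  set L : EReal := sSup ((fun t : ℝ => (h t : EReal)) '' D) with hL
  have hlt : ∀ t ∈ D, (h t : EReal) < L := fun t ht => by
    obtain ⟨t', h1, h2⟩ := exists_gt_mem_Ico_ereal ht
    exact lt_of_lt_of_le (EReal.coe_lt_coe_iff.2 (hmono ht h2 h1)) (le_sSup ⟨t', h2, rfl⟩)
  refine ⟨L, ?_, ?_, hmono.injOn, ?_⟩
  · have hev : ∀ t₀ ∈ D, ∀ᶠ t : ℝ in comap (fun t : ℝ => (t : EReal)) (𝓝[<] M),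
        t₀ < t ∧ t ∈ D := fun t₀ ht₀ => by
      filter_upwards [preimage_mem_comap (Ioo_mem_nhdsLT ht₀.2)]
      rintro t ⟨h1, h2⟩
      have h1' : t₀ < t := EReal.coe_lt_coe_iff.1 h1
      exact ⟨h1', ht₀.1.trans h1'.le, h2⟩
    refine tendsto_order.2 ⟨fun a ha => ?_, fun a ha => ?_⟩
    · obtain ⟨_, ⟨t₀, ht₀, rfl⟩, hat⟩ := lt_sSup_iff.1 ha
      filter_upwards [hev t₀ ht₀] with t ht
      exact hat.trans (EReal.coe_lt_coe_iff.2 (hmono ht₀ ht.2 ht.1))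
    · filter_upwards [hev 0 h0D] with t ht
      exact (hlt t ht.2).trans ha
  · intro t ht
    refine ⟨?_, hlt t ht⟩
    rw [← h0]
    exact hmono.monotoneOn h0D ht ht.1
  · rintro s ⟨hs0, hsL⟩
    obtain ⟨_, ⟨b, hb, rfl⟩, hsb⟩ := lt_sSup_iff.1 hsL
    have hsb' : s < h b := EReal.coe_lt_coe_iff.1 hsb
    obtain ⟨t, ht, rfl⟩ := intermediate_value_Icc hb.1 (hcont b hb)
      (show s ∈ Icc (h 0) (h b) from ⟨by rwa [h0], hsb'.le⟩)
    exact ⟨t, ⟨ht.1, lt_of_le_of_lt (EReal.coe_le_coe_iff.2 ht.2) hb.2⟩, rfl⟩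

/-- The inverse of the derivative `h` of a convex function `K` is integrable, and its primitive is
bounded by the Legendre transform of `K`. -/
theorem integral_invFunOn_le {L : EReal} (hM : 0 < M)
    (hmono : StrictMonoOn h {t : ℝ | 0 ≤ t ∧ (t : EReal) < M}) (h0 : h 0 = 0) (hK0 : K 0 = 0)
    (hK : ∀ a b : ℝ, (0 ≤ a ∧ (a : EReal) < M) → (0 ≤ b ∧ (b : EReal) < M) →
      K b + h b * (a - b) ≤ K a)
    (hbij : BijOn h {t : ℝ | 0 ≤ t ∧ (t : EReal) < M} {s : ℝ | 0 ≤ s ∧ (s : EReal) < L})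
    {x : ℝ} (hx : 0 < x) (hxL : (x : EReal) < L) :
    (0 ≤ Function.invFunOn h {t : ℝ | 0 ≤ t ∧ (t : EReal) < M} x ∧
      ((Function.invFunOn h {t : ℝ | 0 ≤ t ∧ (t : EReal) < M} x : ℝ) : EReal) < M) ∧
    IntervalIntegrable (Function.invFunOn h {t : ℝ | 0 ≤ t ∧ (t : EReal) < M}) volume 0 x ∧
    ∫ s in (0 : ℝ)..x, Function.invFunOn h {t : ℝ | 0 ≤ t ∧ (t : EReal) < M} s ≤
      x * Function.invFunOn h {t : ℝ | 0 ≤ t ∧ (t : EReal) < M} x -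
        K (Function.invFunOn h {t : ℝ | 0 ≤ t ∧ (t : EReal) < M} x) := by
  set D : Set ℝ := {t : ℝ | 0 ≤ t ∧ (t : EReal) < M} with hD
  set g := Function.invFunOn h D with hg
  have h0D : (0 : ℝ) ∈ D := ⟨le_rfl, by simpa using hM⟩
  have hmem : ∀ s ∈ Icc 0 x, s ∈ {s : ℝ | 0 ≤ s ∧ (s : EReal) < L} := fun s hs =>
    ⟨hs.1, lt_of_le_of_lt (EReal.coe_le_coe_iff.2 hs.2) hxL⟩
  have hgD : ∀ s ∈ Icc 0 x, g s ∈ D := fun s hs =>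
    Function.invFunOn_mem (hbij.surjOn (hmem s hs))
  have hhg : ∀ s ∈ Icc 0 x, h (g s) = s := fun s hs =>
    Function.invFunOn_eq (hbij.surjOn (hmem s hs))
  have hgm : MonotoneOn g (Icc 0 x) := fun a ha b hb hab => by
    rw [← hmono.le_iff_le (hgD a ha) (hgD b hb), hhg a ha, hhg b hb]
    exact hab
  have hx' : x ∈ Icc 0 x := ⟨hx.le, le_rfl⟩
  have h0' : (0 : ℝ) ∈ Icc 0 x := ⟨le_rfl, hx.le⟩
  have hg0 : g 0 = 0 := hbij.injOn (hgD 0 h0') h0D (by rw [hhg 0 h0', h0])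
  refine ⟨hgD x hx', MonotoneOn.intervalIntegrable (by rwa [uIcc_of_le hx.le]), ?_⟩
  -- $\Phi$ is the Legendre transform of `K`; the tangent inequality of `K` at `g b`, evaluated at
  -- `g a`, says that `g` is a subgradient of $\Phi$.
  have h1 := integral_le_sub_of_subgradient (Φ := fun s => s * g s - K (g s)) hx hgm
    (fun a ha b hb => by
      have := hK (g a) (g b) (hgD a ha) (hgD b hb)
      rw [hhg b hb] at this
      linarith)
  simpa [hg0, hK0] using h1

end InverseRate

/-! ### The rate function and its primitive. -/

section Rate

variable {ν₁ : Measure ℝ}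

theorem exp_sub_one_le_mul_exp (y : ℝ) : Real.exp y - 1 ≤ y * Real.exp y := by
  have h := mul_le_mul_of_nonneg_right (Real.add_one_le_exp (-y)) (Real.exp_pos y).le
  rw [← Real.exp_add, neg_add_cancel, Real.exp_zero] at h
  linarith

theorem exp_sub_one_sub_le_mul (y : ℝ) : Real.exp y - 1 - y ≤ y * (Real.exp y - 1) := by
  linarith [exp_sub_one_le_mul_exp y]

theorem exp_mul_abs_sub_one_nonneg {t : ℝ} (ht : 0 ≤ t) (u : ℝ) :
    0 ≤ Real.exp (t * |u|) - 1 := by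
  linarith [Real.one_le_exp (mul_nonneg ht (abs_nonneg u))]

/-- For small jumps $e^{t|u|}-1$ supplies one power of $|u|$, so `1 ≤ k` yields $u^2$; for large
ones the gap $s-t$ absorbs $|u|^k$. -/
theorem IsLevyMeasure.integrable_pow_mul_exp_sub_one (hν₁ : IsLevyMeasure ν₁) {s t : ℝ}
    (ht : 0 ≤ t) (hts : t < s)
    (hs : IntegrableOn (fun u => Real.exp (s * |u|)) {u | 1 < ‖u‖} ν₁) {k : ℕ} (hk : 1 ≤ k) :
    Integrable (fun u => |u| ^ k * (Real.exp (t * |u|) - 1)) ν₁ := by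
  have hd : Integrable (fun u => t * Real.exp t * min 1 (‖u‖ ^ 2) +
      (k.factorial / (s - t) ^ k : ℝ) *
        {u | 1 < ‖u‖}.indicator (fun u => Real.exp (s * |u|)) u) ν₁ :=
    (hν₁.integrable_min.const_mul _).add
      (((integrable_indicator_iff (measurableSet_lt_norm 1)).2 hs).const_mul _)
  refine hd.mono' (by fun_prop) (.of_forall fun u => ?_)
  have hst : 0 < s - t := sub_pos.2 hts
  rw [Real.norm_of_nonneg (mul_nonneg (by positivity) (exp_mul_abs_sub_one_nonneg ht u))]
  by_cases hu : 1 < ‖u‖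
  · rw [indicator_of_mem (show u ∈ {u : ℝ | 1 < ‖u‖} from hu)]
    refine le_add_of_nonneg_of_le (by positivity) ?_
    have h1 := Real.pow_div_factorial_le_exp ((s - t) * |u|) (by positivity) k
    rw [mul_pow, div_le_iff₀ (by positivity)] at h1
    have h2 : Real.exp (s * |u|) = Real.exp ((s - t) * |u|) * Real.exp (t * |u|) := by
      rw [← Real.exp_add]; ring_nf
    rw [h2, div_mul_eq_mul_div, le_div_iff₀ (by positivity)]
    have h3 : 0 ≤ |u| ^ k * (s - t) ^ k := by positivity
    calc |u| ^ k * (Real.exp (t * |u|) - 1) * (s - t) ^ k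
        ≤ ((s - t) ^ k * |u| ^ k) * Real.exp (t * |u|) := by nlinarith
      _ ≤ (Real.exp ((s - t) * |u|) * k.factorial) * Real.exp (t * |u|) := by gcongr
      _ = _ := by ring
  · rw [indicator_of_notMem (show u ∉ {u : ℝ | 1 < ‖u‖} from hu), mul_zero, add_zero]
    have hu' : |u| ≤ 1 := not_lt.1 hu
    rw [Real.norm_eq_abs, min_eq_right (pow_le_one₀ (abs_nonneg u) hu')]
    have h1 : |u| ^ k ≤ |u| := pow_le_of_le_one (abs_nonneg u) hu' (by omega)
    have h2 : Real.exp (t * |u|) - 1 ≤ t * |u| * Real.exp t := by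
      refine (exp_sub_one_le_mul_exp _).trans ?_
      gcongr
      nlinarith
    calc _ ≤ |u| * (t * |u| * Real.exp t) :=
          mul_le_mul h1 h2 (exp_mul_abs_sub_one_nonneg ht u) (abs_nonneg u)
      _ = _ := by ring

/-- The derivative of `levyLog`. -/
noncomputable def levyRate (c : ℝ) (ν₁ : Measure ℝ) (t : ℝ) : ℝ :=
  ∫ u, (8 * |u| + c * |u| ^ 3) * (Real.exp (t * |u|) - 1) ∂ν₁

/-- A bound for the logarithm of the centred Laplace transform. -/
noncomputable def levyLog (c : ℝ) (ν₁ : Measure ℝ) (t : ℝ) : ℝ :=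
  ∫ u, (8 + c * |u| ^ 2) * (Real.exp (t * |u|) - 1 - t * |u|) ∂ν₁

theorem levyRate_zero (c : ℝ) : levyRate c ν₁ 0 = 0 := by simp [levyRate]

theorem levyLog_zero (c : ℝ) : levyLog c ν₁ 0 = 0 := by simp [levyLog]

theorem IsLevyMeasure.integrable_levyRate (hν₁ : IsLevyMeasure ν₁) {s t : ℝ}
    (ht : 0 ≤ t) (hts : t < s)
    (hs : IntegrableOn (fun u => Real.exp (s * |u|)) {u | 1 < ‖u‖} ν₁) (c : ℝ) :
    Integrable (fun u => (8 * |u| + c * |u| ^ 3) * (Real.exp (t * |u|) - 1)) ν₁ := by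
  have h1 := (hν₁.integrable_pow_mul_exp_sub_one ht hts hs le_rfl).const_mul 8
  have h3 := (hν₁.integrable_pow_mul_exp_sub_one ht hts hs (k := 3) (by norm_num)).const_mul c
  refine (h1.add h3).congr (.of_forall fun u => ?_)
  simp only [Pi.add_apply]
  ring

theorem IsLevyMeasure.levyRate_eq (hν₁ : IsLevyMeasure ν₁) {s t : ℝ}
    (ht : 0 ≤ t) (hts : t < s)
    (hs : IntegrableOn (fun u => Real.exp (s * |u|)) {u | 1 < ‖u‖} ν₁) (c : ℝ) :
    levyRate c ν₁ t = 8 * ∫ u, |u| * (Real.exp (t * |u|) - 1) ∂ν₁ +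
      c * ∫ u, |u| ^ 3 * (Real.exp (t * |u|) - 1) ∂ν₁ := by
  have h1 := hν₁.integrable_pow_mul_exp_sub_one ht hts hs le_rfl
  simp only [pow_one] at h1
  have h3 := hν₁.integrable_pow_mul_exp_sub_one ht hts hs (k := 3) (by norm_num)
  rw [levyRate, ← integral_const_mul, ← integral_const_mul,
    ← integral_add (h1.const_mul _) (h3.const_mul _)]
  congr 1
  ext u
  ring

theorem IsLevyMeasure.integrable_levyLog (hν₁ : IsLevyMeasure ν₁) {s t : ℝ}
    (ht : 0 ≤ t) (hts : t < s)
    (hs : IntegrableOn (fun u => Real.exp (s * |u|)) {u | 1 < ‖u‖} ν₁) {c : ℝ} (hc : 0 ≤ c) :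
    Integrable (fun u => (8 + c * |u| ^ 2) * (Real.exp (t * |u|) - 1 - t * |u|)) ν₁ := by
  refine ((hν₁.integrable_levyRate ht hts hs c).const_mul t).mono' (by fun_prop)
    (.of_forall fun u => ?_)
  rw [Real.norm_of_nonneg (mul_nonneg (by positivity) (exp_sub_one_sub_nonneg _))]
  calc _ ≤ (8 + c * |u| ^ 2) * (t * |u| * (Real.exp (t * |u|) - 1)) := by
        gcongr
        exact exp_sub_one_sub_le_mul _
    _ = _ := by ring

variable {M : EReal}
  (hM : ∀ t : ℝ, 0 ≤ t → (t : EReal) < M →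
    IntegrableOn (fun u => Real.exp (t * |u|)) {u | 1 < ‖u‖} ν₁)

include hM

/-- The tangent inequality $e^{a|u|}\ge e^{b|u|}(1+(a-b)|u|)$ is integrated against `ν₁`. The
Legendre argument uses only this, so no differentiation under the integral occurs. -/
theorem IsLevyMeasure.levyLog_add_le (hν₁ : IsLevyMeasure ν₁) {c : ℝ} (hc : 0 ≤ c) {a b : ℝ}
    (ha : 0 ≤ a ∧ (a : EReal) < M) (hb : 0 ≤ b ∧ (b : EReal) < M) :
    levyLog c ν₁ b + levyRate c ν₁ b * (a - b) ≤ levyLog c ν₁ a := by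
  obtain ⟨a', haa', ha'⟩ := exists_gt_mem_Ico_ereal ha
  obtain ⟨b', hbb', hb'⟩ := exists_gt_mem_Ico_ereal hb
  have hia := hν₁.integrable_levyLog ha.1 haa' (hM a' ha'.1 ha'.2) hc
  have hib := hν₁.integrable_levyLog hb.1 hbb' (hM b' hb'.1 hb'.2) hc
  have hir := hν₁.integrable_levyRate hb.1 hbb' (hM b' hb'.1 hb'.2) c
  rw [levyLog, levyRate, levyLog, ← integral_mul_const, ← integral_add hib (hir.mul_const _)]
  refine integral_mono (hib.add (hir.mul_const _)) hia fun u => ?_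
  have h1 : Real.exp (b * |u|) * (1 + (a - b) * |u|) ≤ Real.exp (a * |u|) := by
    have h2 : Real.exp (a * |u|) = Real.exp (b * |u|) * Real.exp ((a - b) * |u|) := by
      rw [← Real.exp_add]; ring_nf
    rw [h2]
    gcongr
    linarith [Real.add_one_le_exp ((a - b) * |u|)]
  have h3 : 0 ≤ 8 + c * |u| ^ 2 := by positivity
  calc _ = (8 + c * |u| ^ 2) *
        (Real.exp (b * |u|) * (1 + (a - b) * |u|) - 1 - a * |u|) := by ring
    _ ≤ _ := by gcongr

theorem IsLevyMeasure.strictMonoOn_levyRate (hν₁ : IsLevyMeasure ν₁) (hne : ν₁ ≠ 0) {c : ℝ}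
    (hc : 0 ≤ c) : StrictMonoOn (levyRate c ν₁) {t : ℝ | 0 ≤ t ∧ (t : EReal) < M} := by
  intro a ha b hb hab
  obtain ⟨a', haa', ha'⟩ := exists_gt_mem_Ico_ereal ha
  obtain ⟨b', hbb', hb'⟩ := exists_gt_mem_Ico_ereal hb
  have hia := hν₁.integrable_levyRate ha.1 haa' (hM a' ha'.1 ha'.2) c
  have hib := hν₁.integrable_levyRate hb.1 hbb' (hM b' hb'.1 hb'.2) c
  rw [← sub_pos, levyRate, levyRate, ← integral_sub hib hia]
  have hpos : ∀ u : ℝ, u ≠ 0 → 0 < (8 * |u| + c * |u| ^ 3) * (Real.exp (b * |u|) - 1) -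
      (8 * |u| + c * |u| ^ 3) * (Real.exp (a * |u|) - 1) := fun u hu => by
    have hu' : 0 < |u| := abs_pos.2 hu
    have h1 : Real.exp (a * |u|) < Real.exp (b * |u|) := Real.exp_lt_exp.2 (by gcongr)
    have h2 : 0 < 8 * |u| + c * |u| ^ 3 := by positivity
    rw [← mul_sub]
    exact mul_pos h2 (by linarith)
  have hpos' : ∀ u : ℝ, 0 ≤ (8 * |u| + c * |u| ^ 3) * (Real.exp (b * |u|) - 1) -
      (8 * |u| + c * |u| ^ 3) * (Real.exp (a * |u|) - 1) := fun u => by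
    rcases eq_or_ne u 0 with rfl | hu
    · simp
    · exact (hpos u hu).le
  -- The integrand is positive off the origin, and a nonzero measure without atom at `0` charges
  -- that set.
  rw [integral_pos_iff_support_of_nonneg hpos' (hib.sub hia)]
  refine lt_of_lt_of_le (b := ν₁ {0}ᶜ) ?_ (measure_mono fun u hu => (hpos u hu).ne')
  rw [pos_iff_ne_zero]
  intro h0
  refine hne (Measure.measure_univ_eq_zero.1 (le_antisymm ?_ zero_le))
  calc ν₁ univ ≤ ν₁ {0} + ν₁ {0}ᶜ := by
        rw [← union_compl_self ({0} : Set ℝ)]; exact measure_union_le _ _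
    _ = 0 := by rw [hν₁.no_atom_zero, h0, add_zero]

theorem IsLevyMeasure.continuousOn_levyRate (hν₁ : IsLevyMeasure ν₁) {c : ℝ}
    (hc : 0 ≤ c) {b : ℝ} (hb : 0 ≤ b ∧ (b : EReal) < M) :
    ContinuousOn (levyRate c ν₁) (Icc 0 b) := by
  obtain ⟨b', hbb', hb'⟩ := exists_gt_mem_Ico_ereal hb
  refine continuousOn_of_dominated (fun t _ => by fun_prop) (fun t ht => .of_forall fun u => ?_)
    (hν₁.integrable_levyRate hb.1 hbb' (hM b' hb'.1 hb'.2) c)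
    (.of_forall fun u => by fun_prop)
  rw [Real.norm_of_nonneg (mul_nonneg (by positivity) (exp_mul_abs_sub_one_nonneg ht.1 u))]
  gcongr
  exact ht.2

end Rate

/-! ### Integration against a measure carried by the axes. -/

section AxisMeasure

variable {d : ℕ} {ν₁ : Measure ℝ}

theorem measurable_euclideanSpace_single (k : Fin d) :
    Measurable fun u : ℝ => EuclideanSpace.single k u := by
  have h : (fun u : ℝ => EuclideanSpace.single k u) =
      fun u : ℝ => u • EuclideanSpace.single k (1 : ℝ) := by
    ext u i
    simp
  rw [h]
  fun_prop

theorem integrable_axisMeasure {F : Type*} [NormedAddCommGroup F]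
    {f : EuclideanSpace ℝ (Fin d) → F} (hf : StronglyMeasurable f) :
    Integrable f (axisMeasure d ν₁) ↔
      ∀ k, Integrable (fun u => f (EuclideanSpace.single k u)) ν₁ := by
  simp only [axisMeasure, integrable_finsetSum_measure, Finset.mem_univ, true_implies]
  exact forall_congr' fun k => integrable_map_measure hf.aestronglyMeasurable
    (measurable_euclideanSpace_single k).aemeasurable

theorem integral_axisMeasure {F : Type*} [NormedAddCommGroup F] [NormedSpace ℝ F]
    {f : EuclideanSpace ℝ (Fin d) → F} (hf : StronglyMeasurable f)
    (hi : ∀ k, Integrable (fun u => f (EuclideanSpace.single k u)) ν₁) :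
    ∫ u, f u ∂(axisMeasure d ν₁) = ∑ k, ∫ u, f (EuclideanSpace.single k u) ∂ν₁ := by
  rw [axisMeasure, integral_finsetSum_measure]
  · exact Finset.sum_congr rfl fun k _ => integral_map
      (measurable_euclideanSpace_single k).aemeasurable hf.aestronglyMeasurable
  · intro k _
    exact (integrable_map_measure hf.aestronglyMeasurable
      (measurable_euclideanSpace_single k).aemeasurable).2 (hi k)

end AxisMeasure

/-- After division by the squares, the power series $\sum y^n/(n+2)!$ and $\sum z^n/(n+2)!$ are
compared termwise. The multiplied form also covers `y = 0` and `z = 0`. -/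
theorem exp_sub_one_sub_mul_sq_le {y z : ℝ} (h : |y| ≤ z) :
    (Real.exp y - 1 - y) * z ^ 2 ≤ y ^ 2 * (Real.exp z - 1 - z) := by
  have hs : ∀ w : ℝ, HasSum (fun n : ℕ => w ^ (n + 2) / (n + 2).factorial)
      (Real.exp w - 1 - w) := fun w => by
    have h1 : HasSum (fun n : ℕ => w ^ n / n.factorial) (Real.exp w) := by
      rw [Real.exp_eq_exp_ℝ]
      exact NormedSpace.expSeries_div_hasSum_exp w
    have h2 := (hasSum_nat_add_iff' 2).2 h1
    simpa [Finset.sum_range_succ, sub_sub] using h2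
  refine hasSum_le (fun n => ?_) ((hs y).mul_right (z ^ 2)) ((hs z).mul_left (y ^ 2))
  have hy : y ^ n ≤ z ^ n := by
    refine (le_abs_self _).trans ?_
    rw [abs_pow]
    gcongr
  calc _ = (y ^ 2 * z ^ 2) * y ^ n / (n + 2).factorial := by ring
    _ ≤ (y ^ 2 * z ^ 2) * z ^ n / (n + 2).factorial := by gcongr
    _ = _ := by ring

/-! ### Increments of the truncated norm along the axes. -/

section NormIncrements

variable {d : ℕ}

theorem norm_add_single_sq (x : EuclideanSpace ℝ (Fin d)) (k : Fin d) (u : ℝ) :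
    ‖x + EuclideanSpace.single k u‖ ^ 2 = ‖x‖ ^ 2 + 2 * (x k * u) + u ^ 2 := by
  rw [norm_add_sq_real, EuclideanSpace.inner_single_right]
  simp [mul_comm]

/-- $|p-q|\,q\le|p^2-q^2|$ for nonnegative $p,q$, and truncation from below does not enlarge the
difference of squares. For norms that difference is a polynomial in the jump. -/
theorem abs_max_sub_max_mul_le {r r' a e : ℝ} (hr : 0 ≤ r) (hr' : 0 ≤ r') (ha : 0 ≤ a)
    (he : |r' ^ 2 - r ^ 2| ≤ e) : |max r' a - max r a| * max r a ≤ e := by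
  have h1 : |max r' a ^ 2 - max r a ^ 2| ≤ |r' ^ 2 - r ^ 2| := by
    have hm : ∀ q : ℝ, 0 ≤ q → max q a ^ 2 = max (q ^ 2) (a ^ 2) := fun q hq => by
      rcases le_total q a with h | h
      · rw [max_eq_right h, max_eq_right (by gcongr)]
      · rw [max_eq_left h, max_eq_left (by gcongr)]
    rw [hm r' hr', hm r hr]
    exact abs_max_sub_max_le_abs _ _ _
  have hN : 0 ≤ max r a := le_max_of_le_left hr
  have hN' : 0 ≤ max r' a := le_max_of_le_left hr'
  refine le_trans ?_ (h1.trans he)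
  rw [sq_sub_sq, abs_mul, mul_comm, abs_of_nonneg (by linarith : 0 ≤ max r' a + max r a)]
  gcongr
  linarith

/-- The norm, truncated to the interval `[a, b]`. -/
noncomputable def truncNorm (a b : ℝ) (x : EuclideanSpace ℝ (Fin d)) : ℝ := min (max ‖x‖ a) b

theorem abs_truncNorm_sub_le (a b : ℝ) (x y : EuclideanSpace ℝ (Fin d)) :
    |truncNorm a b y - truncNorm a b x| ≤ |max ‖y‖ a - max ‖x‖ a| := by
  have h := abs_min_sub_min_le_max (max ‖y‖ a) b (max ‖x‖ a) b
  simpa [truncNorm] using h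

theorem abs_truncNorm_add_single_sub_le (a b : ℝ) (x : EuclideanSpace ℝ (Fin d)) (k : Fin d)
    (u : ℝ) : |truncNorm a b (x + EuclideanSpace.single k u) - truncNorm a b x| ≤ |u| := by
  refine (abs_truncNorm_sub_le _ _ _ _).trans ((abs_max_sub_max_le_abs _ _ _).trans ?_)
  refine (abs_norm_sub_norm_le _ _).trans ?_
  simp

theorem sum_sq_truncNorm_add_single_sub_le {a : ℝ} (ha : 0 < a) (b : ℝ)
    (x : EuclideanSpace ℝ (Fin d)) (u : ℝ) :
    ∑ k, (truncNorm a b (x + EuclideanSpace.single k u) - truncNorm a b x) ^ 2 ≤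
      (8 + 2 * d / a ^ 2 * |u| ^ 2) * |u| ^ 2 := by
  set N := max ‖x‖ a with hN
  have hNa : a ≤ N := le_max_right _ _
  have hNx : ‖x‖ ≤ N := le_max_left _ _
  have hN0 : 0 < N := ha.trans_le hNa
  have hk : ∀ k, (truncNorm a b (x + EuclideanSpace.single k u) - truncNorm a b x) ^ 2 * N ^ 2 ≤
      8 * u ^ 2 * x k ^ 2 + 2 * u ^ 4 := fun k => by
    have h1 : |truncNorm a b (x + EuclideanSpace.single k u) - truncNorm a b x| * N ≤
        |2 * (x k * u) + u ^ 2| := by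
      refine le_trans ?_ (abs_max_sub_max_mul_le (norm_nonneg x)
        (norm_nonneg (x + EuclideanSpace.single k u)) ha.le (le_of_eq ?_))
      · exact mul_le_mul_of_nonneg_right (abs_truncNorm_sub_le _ _ _ _) hN0.le
      · rw [norm_add_single_sq]; ring_nf
    have h2 := pow_le_pow_left₀ (by positivity) h1 2
    rw [mul_pow, sq_abs, sq_abs] at h2
    -- $(p+q)^2\le2p^2+2q^2$ with $p=2x_ku$ and $q=u^2$: the source of the constants 8 and 2.
    nlinarith [sq_nonneg (2 * (x k * u) - u ^ 2)]
  have hx2 : ∑ k, x k ^ 2 = ‖x‖ ^ 2 := by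
    rw [EuclideanSpace.norm_sq_eq]
    simp
  have hsum : (∑ k, (truncNorm a b (x + EuclideanSpace.single k u) - truncNorm a b x) ^ 2) * N ^ 2
      ≤ 8 * u ^ 2 * N ^ 2 + d * (2 * u ^ 4) := by
    rw [Finset.sum_mul]
    refine (Finset.sum_le_sum fun k _ => hk k).trans ?_
    rw [Finset.sum_add_distrib, ← Finset.mul_sum, hx2]
    simp only [Finset.sum_const, Finset.card_univ, Fintype.card_fin, nsmul_eq_mul]
    gcongr
  rw [sq_abs]
  calc _ ≤ (8 * u ^ 2 * N ^ 2 + d * (2 * u ^ 4)) / N ^ 2 := by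
        rwa [le_div_iff₀ (by positivity)]
    _ = 8 * u ^ 2 + d * (2 * u ^ 4) / N ^ 2 := by field_simp
    _ ≤ 8 * u ^ 2 + d * (2 * u ^ 4) / a ^ 2 := by gcongr
    _ = _ := by ring

/-- Each increment is at most $|u|$ in absolute value, so $e^y-1-y$ is at most quadratic in it with
the constant attained at $T|u|$; the sum of squares then concludes. -/
theorem sum_exp_truncNorm_increments_le {a : ℝ} (ha : 0 < a) (b : ℝ) {T : ℝ} (hT : 0 ≤ T)
    (x : EuclideanSpace ℝ (Fin d)) (u : ℝ) :
    ∑ k, (Real.exp (T * truncNorm a b (x + EuclideanSpace.single k u) - T * truncNorm a b x) - 1 -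
      (T * truncNorm a b (x + EuclideanSpace.single k u) - T * truncNorm a b x)) ≤
      (8 + 2 * d / a ^ 2 * |u| ^ 2) * (Real.exp (T * |u|) - 1 - T * |u|) := by
  rcases eq_or_ne u 0 with rfl | hu
  · have h0 : ∀ k : Fin d, EuclideanSpace.single k (0 : ℝ) = 0 := fun k => by ext i; simp
    simp [h0]
  have hu' : 0 < |u| := abs_pos.2 hu
  have hφ := exp_sub_one_sub_nonneg (T * |u|)
  have hk : ∀ k : Fin d, (Real.exp (T * truncNorm a b (x + EuclideanSpace.single k u) -
      T * truncNorm a b x) - 1 -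
      (T * truncNorm a b (x + EuclideanSpace.single k u) - T * truncNorm a b x)) ≤
      (truncNorm a b (x + EuclideanSpace.single k u) - truncNorm a b x) ^ 2 *
        ((Real.exp (T * |u|) - 1 - T * |u|) / |u| ^ 2) := by
    intro k
    have h1 := abs_truncNorm_add_single_sub_le a b x k u
    rw [← mul_sub]
    rcases eq_or_lt_of_le hT with h0 | hT0
    · simp [← h0]
    have h2 := exp_sub_one_sub_mul_sq_le
      (y := T * (truncNorm a b (x + EuclideanSpace.single k u) - truncNorm a b x))
      (z := T * |u|) (by rw [abs_mul, abs_of_nonneg hT]; gcongr)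
    rw [← mul_div_assoc, le_div_iff₀ (by positivity)]
    rw [mul_pow, mul_pow] at h2
    refine le_of_mul_le_mul_left ?_ (pow_pos hT0 2)
    linarith
  refine (Finset.sum_le_sum fun k _ => hk k).trans ?_
  rw [← Finset.sum_mul]
  calc _ ≤ (8 + 2 * d / a ^ 2 * |u| ^ 2) * |u| ^ 2 *
        ((Real.exp (T * |u|) - 1 - T * |u|) / |u| ^ 2) := by
        gcongr
        exact sum_sq_truncNorm_add_single_sub_le ha b x u
    _ = _ := by field_simp

end NormIncrements

/-! ### The Chernoff bound. -/

section Tail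

variable {Ω : Type*} [MeasurableSpace Ω] {P : Measure Ω} [IsProbabilityMeasure P] {d : ℕ}
  {X : Ω → EuclideanSpace ℝ (Fin d)} {γ : EuclideanSpace ℝ (Fin d)} {ν₁ : Measure ℝ}

/-- Chernoff-type bound for the norm of an infinitely divisible vector whose Lévy measure is
carried by the axes. -/
theorem IsID.measure_le_norm_le (hX : IsID P X γ (axisMeasure d ν₁)) (hν₁ : IsLevyMeasure ν₁)
    (hi : Integrable (fun ω => ‖X ω‖) P) (hpos : 0 < ∫ ω, ‖X ω‖ ∂P) {ε : ℝ} (hε : 0 < ε)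
    {s T : ℝ} (hT : 0 ≤ T) (hTs : T < s)
    (hs : IntegrableOn (fun u => Real.exp (s * |u|)) {u | 1 < ‖u‖} ν₁) {x : ℝ} (hx : 0 ≤ x) :
    P {ω | (1 + ε) * (∫ ω', ‖X ω'‖ ∂P) + x ≤ ‖X ω‖} ≤ ENNReal.ofReal
      (Real.exp (levyLog (2 * d / (ε * ∫ ω, ‖X ω‖ ∂P) ^ 2) ν₁ T - T * x)) := by
  set m := ∫ ω, ‖X ω‖ ∂P with hm
  set a := ε * m with ha
  set b := (1 + ε) * m + x with hb
  have ha0 : 0 < a := by positivity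
  have hb0 : 0 < b := by positivity
  have hcont : Continuous (truncNorm a b : EuclideanSpace ℝ (Fin d) → ℝ) := by
    unfold truncNorm; fun_prop
  have hnn : ∀ y : EuclideanSpace ℝ (Fin d), 0 ≤ truncNorm a b y := fun y =>
    le_min (le_max_of_le_right ha0.le) hb0.le
  have habs : ∀ y : EuclideanSpace ℝ (Fin d), |truncNorm a b y| ≤ b := fun y => by
    rw [abs_of_nonneg (hnn y)]; exact min_le_right _ _
  have hbd : ∀ y : EuclideanSpace ℝ (Fin d), |T * truncNorm a b y| ≤ T * b := fun y => by
    rw [abs_mul, abs_of_nonneg hT]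
    gcongr
    exact habs y
  have hdom := hν₁.integrable_levyLog hT hTs hs (c := 2 * d / a ^ 2) (by positivity)
  have hmeas := hcont.measurable
  have hsingle := fun k : Fin d => measurable_euclideanSpace_single k
  have hκi : ∀ (y : EuclideanSpace ℝ (Fin d)) (k : Fin d), Integrable (fun u =>
      Real.exp (T * truncNorm a b (y + EuclideanSpace.single k u) - T * truncNorm a b y) - 1 -
      (T * truncNorm a b (y + EuclideanSpace.single k u) - T * truncNorm a b y)) ν₁ := by
    intro y k
    have hsk := hsingle k
    refine hdom.mono' (by fun_prop) (.of_forall fun u => ?_)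
    rw [Real.norm_of_nonneg (exp_sub_one_sub_nonneg _)]
    refine le_trans ?_ (sum_exp_truncNorm_increments_le ha0 b hT y u)
    exact Finset.single_le_sum (f := fun k => Real.exp (T * truncNorm a b
      (y + EuclideanSpace.single k u) - T * truncNorm a b y) - 1 -
      (T * truncNorm a b (y + EuclideanSpace.single k u) - T * truncNorm a b y))
      (fun k _ => exp_sub_one_sub_nonneg _) (Finset.mem_univ k)
  have hexp := hX.integral_exp_le (F := fun y => T * truncNorm a b y) (by fun_prop) hbd
    (κ := levyLog (2 * d / a ^ 2) ν₁ T) (fun y => by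
      have hsm : StronglyMeasurable fun u =>
          Real.exp (T * truncNorm a b (y + u) - T * truncNorm a b y) - 1 -
          (T * truncNorm a b (y + u) - T * truncNorm a b y) :=
        (by fun_prop : Measurable _).stronglyMeasurable
      refine ⟨(integrable_axisMeasure hsm).2 (hκi y), ?_⟩
      rw [integral_axisMeasure hsm (hκi y), ← integral_finsetSum _ fun k _ => hκi y k]
      exact integral_mono (integrable_finsetSum _ fun k _ => hκi y k) hdom
        fun u => sum_exp_truncNorm_increments_le ha0 b hT y u)
  have hXm := hX.measurable
  -- $\max(\|X\|,a)\le\|X\|+a$, whose mean is $(1+\varepsilon)m$.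
  have hEf : ∫ ω, truncNorm a b (X ω) ∂P ≤ (1 + ε) * m := by
    calc _ ≤ ∫ ω, (‖X ω‖ + a) ∂P := by
          refine integral_mono (integrable_of_measurable_of_abs_le (by fun_prop)
            fun ω => habs (X ω)) (hi.add (integrable_const _)) fun ω => ?_
          exact (min_le_left _ _).trans (max_le (by linarith) (by linarith [norm_nonneg (X ω)]))
      _ = _ := by
          rw [integral_add hi (integrable_const _)]
          simp only [integral_const, probReal_univ, smul_eq_mul, ha]
          ring
  have hmk := mul_meas_ge_le_integral_of_nonneg (μ := P)
    (f := fun ω => Real.exp (T * truncNorm a b (X ω))) (.of_forall fun ω => (Real.exp_pos _).le)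
    (integrable_of_measurable_of_abs_le (by fun_prop) (B := Real.exp (T * b)) fun ω => by
      rw [abs_of_pos (Real.exp_pos _)]
      exact Real.exp_le_exp.2 ((le_abs_self _).trans (hbd _))) (Real.exp (T * b))
  have hsub : P.real {ω | b ≤ ‖X ω‖} ≤
      P.real {ω | Real.exp (T * b) ≤ Real.exp (T * truncNorm a b (X ω))} := by
    refine measureReal_mono fun ω hω => ?_
    have h1 : b ≤ ‖X ω‖ := hω
    have h2 : truncNorm a b (X ω) = b := min_eq_right (le_max_of_le_left h1)
    show Real.exp (T * b) ≤ Real.exp (T * truncNorm a b (X ω))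
    rw [h2]
  rw [← ofReal_measureReal]
  refine ENNReal.ofReal_le_ofReal (hsub.trans ?_)
  refine le_of_mul_le_mul_left (hmk.trans (hexp.trans ?_)) (Real.exp_pos (T * b))
  rw [← Real.exp_add]
  refine Real.exp_le_exp.2 ?_
  rw [integral_const_mul]
  have := mul_le_mul_of_nonneg_left hEf hT
  rw [hb]
  linarith

end Tail

/-! ### Moments, transfer to the jumps, and nondegeneracy. -/

section Moments

variable {Ω : Type*} [MeasurableSpace Ω] {P : Measure Ω}

theorem integrable_pow_norm_of_integrable_exp {E : Type*} [NormedAddCommGroup E]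
    [MeasurableSpace E] [BorelSpace E] {X : Ω → E} (hX : Measurable X) {t : ℝ} (ht : 0 < t)
    (hi : Integrable (fun ω => Real.exp (t * ‖X ω‖)) P) (k : ℕ) :
    Integrable (fun ω => ‖X ω‖ ^ k) P := by
  refine (hi.const_mul (k.factorial / t ^ k : ℝ)).mono'
    (hX.norm.pow_const k).aestronglyMeasurable (.of_forall fun ω => ?_)
  rw [Real.norm_of_nonneg (by positivity), div_mul_eq_mul_div, le_div_iff₀ (by positivity)]
  have h := Real.pow_div_factorial_le_exp (t * ‖X ω‖) (by positivity) k
  rw [mul_pow, div_le_iff₀ (by positivity)] at h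
  linarith

theorem integrable_exp_mul_abs_of_lt_expMomentSup {Y : Ω → ℝ} (hY : Measurable Y) {t : ℝ}
    (ht : (t : EReal) < expMomentSup P Y) : Integrable (fun ω => Real.exp (t * |Y ω|)) P := by
  obtain ⟨_, ⟨s, ⟨_, hs⟩, rfl⟩, hts⟩ := lt_sSup_iff.1 ht
  have hts' : t < s := EReal.coe_lt_coe_iff.1 hts
  refine hs.mono' (by fun_prop) (.of_forall fun ω => ?_)
  rw [Real.norm_of_nonneg (Real.exp_pos _).le]
  gcongr

theorem integrable_exp_mul_of_integrable_exp_mul_abs {Y : Ω → ℝ} (hY : Measurable Y) {t s : ℝ}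
    (hst : |s| ≤ t) (h : Integrable (fun ω => Real.exp (t * |Y ω|)) P) :
    Integrable (fun ω => Real.exp (s * Y ω)) P := by
  refine h.mono' (by fun_prop) (.of_forall fun ω => ?_)
  rw [Real.norm_of_nonneg (Real.exp_pos _).le]
  refine Real.exp_le_exp.2 ((le_abs_self _).trans ?_)
  rw [abs_mul]
  gcongr

variable [IsProbabilityMeasure P] {d : ℕ}
  {X : Ω → EuclideanSpace ℝ (Fin d)} {γ : EuclideanSpace ℝ (Fin d)} {ν₁ : Measure ℝ}

theorem inner_single_left_eq (k : Fin d) (t : ℝ) (x : EuclideanSpace ℝ (Fin d)) :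
    inner ℝ (EuclideanSpace.single k t) x = t * x k := by
  rw [EuclideanSpace.inner_single_left]
  simp

theorem IsID.integrableOn_exp_mul (hX : IsID P X γ (axisMeasure d ν₁)) (k : Fin d) {t : ℝ}
    (h : Integrable (fun ω => Real.exp (t * X ω k)) P) :
    IntegrableOn (fun u => Real.exp (t * u)) {u | 1 < ‖u‖} ν₁ := by
  simp only [← inner_single_left_eq] at h
  have h1 := hX.integrableOn_exp_inner h
  rw [← integrable_indicator_iff (measurableSet_lt_norm 1), integrable_axisMeasure] at h1
  · rw [← integrable_indicator_iff (measurableSet_lt_norm 1)]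
    refine (h1 k).congr (.of_forall fun u => ?_)
    simp only [indicator, mem_ofPred_eq, inner_single_left_eq, PiLp.norm_single]
    simp
  · exact ((by fun_prop : Measurable fun u => Real.exp (inner ℝ _ u)).indicator
      (measurableSet_lt_norm 1)).stronglyMeasurable

/-- Exponential moments of a coordinate are inherited by the large jumps. -/
theorem IsID.integrableOn_exp_mul_abs (hX : IsID P X γ (axisMeasure d ν₁)) (k : Fin d) {t : ℝ}
    (ht0 : 0 ≤ t) (ht : (t : EReal) < expMomentSup P fun ω => X ω k) :
    IntegrableOn (fun u => Real.exp (t * |u|)) {u | 1 < ‖u‖} ν₁ := by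
  have hXm := hX.measurable
  have hk : Measurable fun ω => X ω k := by fun_prop
  have hi := integrable_exp_mul_abs_of_lt_expMomentSup hk ht
  have hp := hX.integrableOn_exp_mul k
    (integrable_exp_mul_of_integrable_exp_mul_abs hk (s := t) (abs_of_nonneg ht0).le hi)
  have hn := hX.integrableOn_exp_mul k
    (integrable_exp_mul_of_integrable_exp_mul_abs hk (s := -t)
      (by rw [abs_neg, abs_of_nonneg ht0]) hi)
  -- $e^{t|u|}\le e^{tu}+e^{-tu}$, and both signs are covered by the moment of $|X_k|$.
  refine (hp.add hn).mono' (by fun_prop) (.of_forall fun u => ?_)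
  rw [Real.norm_of_nonneg (Real.exp_pos _).le, Pi.add_apply]
  rcases abs_choice u with h | h <;> rw [h]
  · linarith [Real.exp_pos (-t * u)]
  · rw [mul_neg, ← neg_mul]
    linarith [Real.exp_pos (t * u)]

/-- Drift and compensator are purely imaginary, so the modulus of the characteristic function sees
only the jumps. -/
theorem IsLevyMeasure.re_levyExponent {ν : Measure (EuclideanSpace ℝ (Fin d))}
    (hν : IsLevyMeasure ν) (γ t : EuclideanSpace ℝ (Fin d)) :
    Integrable (fun u => 1 - Real.cos (inner ℝ t u)) ν ∧
      (levyExponent γ ν t).re = -∫ u, (1 - Real.cos (inner ℝ t u)) ∂ν := by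
  have hm : Measurable fun u : EuclideanSpace ℝ (Fin d) =>
      Complex.exp (Complex.I * ((inner ℝ t u : ℝ) : ℂ)) - 1 -
        Complex.I * ((inner ℝ t u : ℝ) : ℂ) * (if ‖u‖ ≤ 1 then 1 else 0) := by
    have h2 : Measurable fun u : EuclideanSpace ℝ (Fin d) => (if ‖u‖ ≤ 1 then (1 : ℂ) else 0) :=
      Measurable.ite (measurableSet_le measurable_norm measurable_const) measurable_const
        measurable_const
    fun_prop
  have hb := norm_truncated_exponent_le (c := Complex.I) (v := t) (S := univ) (C := 1)
    (fun _ _ => mem_univ _) (fun u _ => (Complex.norm_exp_I_mul_ofReal _).le)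
  simp only [indicator_univ] at hb
  have hi := hν.integrable_of_norm_le hm.aestronglyMeasurable hb
  have hre : ∀ u : EuclideanSpace ℝ (Fin d),
      (Complex.exp (Complex.I * ((inner ℝ t u : ℝ) : ℂ)) - 1 -
        Complex.I * ((inner ℝ t u : ℝ) : ℂ) * (if ‖u‖ ≤ 1 then 1 else 0)).re =
      -(1 - Real.cos (inner ℝ t u)) := fun u => by
    rw [mul_comm Complex.I, Complex.sub_re, Complex.sub_re, Complex.exp_ofReal_mul_I_re]
    split_ifs <;> simp
  have hi' := hi.re
  simp only [RCLike.re_eq_complex_re, hre] at hi'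
  have hi'' := hi'.neg
  simp only [Pi.neg_def, neg_neg] at hi''
  refine ⟨hi'', ?_⟩
  have h3 := integral_re hi
  simp only [RCLike.re_eq_complex_re, hre, integral_neg] at h3
  rw [levyExponent, Complex.add_re, ← h3]
  simp

/-- At a small enough frequency the argument lies within $(-2\pi,2\pi)$. Countably many frequencies
suffice, so the exceptional null sets can be united. -/
theorem eq_zero_of_forall_cos_eq_one {u : ℝ}
    (h : ∀ n : ℕ, Real.cos (1 / ((n : ℝ) + 1) * u) = 1) : u = 0 := by
  obtain ⟨n, hn⟩ := exists_nat_gt |u|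
  have hn0 : (0 : ℝ) < n + 1 := by positivity
  have h1 : |1 / ((n : ℝ) + 1) * u| < 1 := by
    rw [abs_mul, abs_of_pos (by positivity), one_div, inv_mul_lt_iff₀ hn0]
    linarith
  have hπ := Real.pi_gt_three
  have h2 := abs_lt.1 h1
  have h3 := (Real.cos_eq_one_iff_of_lt_of_lt (by linarith) (by linarith)).1 (h n)
  rcases mul_eq_zero.1 h3 with h4 | h4
  · exact absurd h4 (by positivity)
  · exact h4

/-- The coordinates of the infinitely divisible vector are not degenerate at `0`. -/
theorem IsID.integral_abs_pos (hX : IsID P X γ (axisMeasure d ν₁)) (hν₁ : IsLevyMeasure ν₁)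
    (k : Fin d) (hi : Integrable (fun ω => |X ω k|) P) : 0 < ∫ ω, |X ω k| ∂P := by
  refine lt_of_le_of_ne (integral_nonneg fun ω => abs_nonneg _) fun h0 => ?_
  have hν := hX.isLevyMeasure
  have hae : ∀ᵐ ω ∂P, X ω k = 0 := by
    have := (integral_eq_zero_iff_of_nonneg (fun ω => abs_nonneg _) hi).1 h0.symm
    filter_upwards [this] with ω hω
    simpa using hω
  -- The characteristic function along the axis is identically 1; taking the modulus forces
  -- $\int(1-\cos)\,d\nu=0$ with a nonnegative integrand.
  have hcos : ∀ t : ℝ, ∀ᵐ u ∂ν₁, Real.cos (t * u) = 1 := by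
    intro t
    have hch := hX.charFun_eq (EuclideanSpace.single k t)
    have h1 : ∫ ω, Complex.exp (Complex.I * ((inner ℝ (EuclideanSpace.single k t) (X ω) : ℝ) : ℂ))
        ∂P = 1 := by
      rw [integral_congr_ae (g := fun _ => 1)]
      · simp
      · filter_upwards [hae] with ω hω
        rw [inner_single_left_eq, hω]
        simp
    rw [h1] at hch
    have h2 := congrArg norm hch
    rw [norm_one, Complex.norm_exp, eq_comm, Real.exp_eq_one_iff] at h2
    obtain ⟨hint, hre⟩ := hν.re_levyExponent γ (EuclideanSpace.single k t)
    rw [hre, neg_eq_zero, integral_eq_zero_iff_of_nonneg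
      (fun u => sub_nonneg.2 (Real.cos_le_one _)) hint] at h2
    have h3 := (ae_finsetSum_measure_iff.1 h2) k (Finset.mem_univ k)
    filter_upwards [ae_of_ae_map (measurable_euclideanSpace_single k).aemeasurable h3] with u hu
    rw [inner_single_left_eq] at hu
    simp only [PiLp.single_apply, if_true, Pi.zero_apply] at hu
    linarith
  have hzero : ∀ᵐ u ∂ν₁, u = 0 := by
    filter_upwards [ae_all_iff.2 fun n : ℕ => hcos (1 / ((n : ℝ) + 1))] with u hu
    exact eq_zero_of_forall_cos_eq_one hu
  refine hX.ne_zero ?_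
  have hν₁0 : ν₁ = 0 := by
    refine Measure.measure_univ_eq_zero.1 (le_antisymm ?_ zero_le)
    have hc : ν₁ {0}ᶜ = 0 := hzero
    calc ν₁ univ ≤ ν₁ {0} + ν₁ {0}ᶜ := by
          rw [← union_compl_self ({0} : Set ℝ)]; exact measure_union_le _ _
      _ = 0 := by rw [hν₁.no_atom_zero, hc, add_zero]
  simp [axisMeasure, hν₁0]

/-- The variance of $\|X\|$ is nonnegative and $\mathbb{E}\|X\|^2=d\,\mathbb{E}X_1^2$. With the next
bound, this makes $d/(\mathbb{E}\|X\|)^2$ comparable to dimension-free constants. -/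
theorem sq_integral_norm_le (hi : Integrable (fun ω => ‖X ω‖) P)
    (hi2 : ∀ k, Integrable (fun ω => X ω k ^ 2) P) (k₀ : Fin d)
    (hident : ∀ k, IdentDistrib (fun ω => X ω k) (fun ω => X ω k₀) P P) :
    (∫ ω, ‖X ω‖ ∂P) ^ 2 ≤ d * ∫ ω, X ω k₀ ^ 2 ∂P := by
  have hsq : ∀ ω, ‖X ω‖ ^ 2 = ∑ k, X ω k ^ 2 := fun ω => by
    rw [EuclideanSpace.norm_sq_eq]; simp
  have hE : ∫ ω, ‖X ω‖ ^ 2 ∂P = d * ∫ ω, X ω k₀ ^ 2 ∂P := by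
    simp only [hsq]
    rw [integral_finsetSum _ fun k _ => hi2 k]
    have hk : ∀ k, ∫ ω, X ω k ^ 2 ∂P = ∫ ω, X ω k₀ ^ 2 ∂P := fun k =>
      ((hident k).comp (u := fun x : ℝ => x ^ 2) (by fun_prop)).integral_eq
    simp [hk]
  have hi2' : Integrable (fun ω => ‖X ω‖ ^ 2) P := by
    simp only [hsq]
    exact integrable_finsetSum _ fun k _ => hi2 k
  rw [← hE]
  set m := ∫ ω, ‖X ω‖ ∂P with hm
  have h0 : 0 ≤ ∫ ω, (‖X ω‖ ^ 2 - 2 * m * ‖X ω‖ + m ^ 2) ∂P :=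
    integral_nonneg fun ω => by
      show 0 ≤ ‖X ω‖ ^ 2 - 2 * m * ‖X ω‖ + m ^ 2
      nlinarith [sq_nonneg (‖X ω‖ - m)]
  have h1 : ∫ ω, (‖X ω‖ ^ 2 - 2 * m * ‖X ω‖ + m ^ 2) ∂P =
      ∫ ω, ‖X ω‖ ^ 2 ∂P - 2 * m * m + m ^ 2 := by
    rw [integral_add (f := fun ω => ‖X ω‖ ^ 2 - 2 * m * ‖X ω‖)
      (hi2'.sub (hi.const_mul _)) (integrable_const _),
      integral_sub hi2' (hi.const_mul _), integral_const_mul]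
    simp [← hm]
  linarith

omit [IsProbabilityMeasure P] in
-- Cauchy–Schwarz gives $\sum_k|X_k|\le\sqrt d\,\|X\|$ pointwise.
theorem mul_sq_integral_abs_le (hi : Integrable (fun ω => ‖X ω‖) P)
    (hi1 : ∀ k, Integrable (fun ω => |X ω k|) P) (k₀ : Fin d)
    (hident : ∀ k, IdentDistrib (fun ω => X ω k) (fun ω => X ω k₀) P P) :
    d * (∫ ω, |X ω k₀| ∂P) ^ 2 ≤ (∫ ω, ‖X ω‖ ∂P) ^ 2 := by
  have hd : (0 : ℝ) < d := by exact_mod_cast k₀.pos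
  have hpt : ∀ ω, ∑ k, |X ω k| ≤ √d * ‖X ω‖ := fun ω => by
    refine abs_le_of_sq_le_sq' ?_ (by positivity) |>.2
    have h := sq_sum_le_card_mul_sum_sq (s := Finset.univ) (f := fun k => |X ω k|)
    rw [mul_pow, Real.sq_sqrt hd.le, EuclideanSpace.norm_sq_eq]
    simpa using h
  have hE : ∫ ω, ∑ k, |X ω k| ∂P = d * ∫ ω, |X ω k₀| ∂P := by
    rw [integral_finsetSum _ fun k _ => hi1 k]
    have hk : ∀ k, ∫ ω, |X ω k| ∂P = ∫ ω, |X ω k₀| ∂P := fun k =>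
      ((hident k).comp (u := fun x : ℝ => |x|) (by fun_prop)).integral_eq
    simp [hk]
  have h1 : d * ∫ ω, |X ω k₀| ∂P ≤ √d * ∫ ω, ‖X ω‖ ∂P := by
    rw [← hE, ← integral_const_mul]
    exact integral_mono (integrable_finsetSum _ fun k _ => hi1 k) (hi.const_mul _) hpt
  have hnn : 0 ≤ ∫ ω, |X ω k₀| ∂P := integral_nonneg fun ω => abs_nonneg _
  have h2 := pow_le_pow_left₀ (by positivity) h1 2
  rw [mul_pow, mul_pow, Real.sq_sqrt hd.le] at h2
  refine le_of_mul_le_mul_left ?_ hd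
  linarith

end Moments

/-! ### The concentration inequality. -/

theorem theorem4 {Ω : Type*} [MeasurableSpace Ω] (P : Measure Ω) [IsProbabilityMeasure P]
    (d : ℕ) [NeZero d] (X : Ω → EuclideanSpace ℝ (Fin d))
    (γ : EuclideanSpace ℝ (Fin d)) (ν : Measure (EuclideanSpace ℝ (Fin d))) (ν₁ : Measure ℝ)
    (hX : IsID P X γ ν)
    (hν₁ : IsLevyMeasure ν₁)
    (hν : ν = axisMeasure d ν₁)
    (hindep : iIndepFun (fun (k : Fin d) (ω : Ω) => X ω k) P)
    (hident : ∀ k : Fin d, IdentDistrib (fun ω => X ω k) (fun ω => X ω 0) P P)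
    (hexp : ∃ t : ℝ, 0 < t ∧ Integrable (fun ω => Real.exp (t * ‖X ω‖)) P)
    (ε : ℝ) (hε : 0 < ε) :
    let M : EReal := expMomentSup P (fun ω => X ω 0)
    let I₁ : ℝ → ℝ := fun t => ∫ u, |u| * (Real.exp (t * |u|) - 1) ∂ν₁
    let I₃ : ℝ → ℝ := fun t => ∫ u, |u| ^ 3 * (Real.exp (t * |u|) - 1) ∂ν₁
    let h : ℝ → ℝ := fun t =>
      8 * I₁ t + (2 * (d : ℝ)) / (ε * (∫ ω, ‖X ω‖ ∂P)) ^ 2 * I₃ t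
    let D : Set ℝ := {t : ℝ | 0 ≤ t ∧ (t : EReal) < M}
    -- all quantities in the definition of `h` are well defined
    (0 < M ∧ Integrable (fun ω => ‖X ω‖) P ∧ 0 < (∫ ω, ‖X ω‖ ∂P) ∧
      ∀ t ∈ D, Integrable (fun u : ℝ => |u| * (Real.exp (t * |u|) - 1)) ν₁ ∧
        Integrable (fun u : ℝ => |u| ^ 3 * (Real.exp (t * |u|) - 1)) ν₁) ∧
    -- dimension-free bounds on `h`, in terms of `ε`, `ν₁` and the law of `X₁` only
    (Integrable (fun ω => (X ω 0) ^ 2) P ∧ 0 < (∫ ω, |X ω 0| ∂P) ∧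
      ∀ t ∈ D,
        8 * I₁ t + 2 / (ε ^ 2 * ∫ ω, (X ω 0) ^ 2 ∂P) * I₃ t ≤ h t ∧
        h t ≤ 8 * I₁ t + 2 / (ε ^ 2 * (∫ ω, |X ω 0| ∂P) ^ 2) * I₃ t) ∧
    -- `L = h(M⁻)`, the left limit (possibly `+∞`); `h` is a bijection from `[0, M)` onto `[0, L)`
    ∃ L : EReal,
      Tendsto (fun t : ℝ => (h t : EReal)) (comap (fun t : ℝ => (t : EReal)) (𝓝[<] M)) (𝓝 L) ∧
      BijOn h D {s : ℝ | 0 ≤ s ∧ (s : EReal) < L} ∧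
      ∀ x : ℝ, 0 < x → (x : EReal) < L →
        IntervalIntegrable (Function.invFunOn h D) volume 0 x ∧
        P {ω | (1 + ε) * (∫ ω', ‖X ω'‖ ∂P) + x ≤ ‖X ω‖}
          ≤ ENNReal.ofReal (Real.exp (-∫ s in (0 : ℝ)..x, Function.invFunOn h D s)) := by

  subst hν
  intro M I₁ I₃ h D
  obtain ⟨t₀, ht₀, hexp⟩ := hexp
  have hXm := hX.measurable
  have hcoord : ∀ ω k, |X ω k| ≤ ‖X ω‖ := fun ω k => by
    simpa using PiLp.norm_apply_le (X ω) k
  have hiX : Integrable (fun ω => ‖X ω‖) P := by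
    simpa using integrable_pow_norm_of_integrable_exp hXm ht₀ hexp 1
  have hi1 : ∀ k, Integrable (fun ω => |X ω k|) P := fun k =>
    hiX.mono' (by fun_prop) (.of_forall fun ω => by simpa using hcoord ω k)
  have hi2 : ∀ k, Integrable (fun ω => X ω k ^ 2) P := fun k =>
    (integrable_pow_norm_of_integrable_exp hXm ht₀ hexp 2).mono' (by fun_prop)
      (.of_forall fun ω => by
        rw [norm_pow, Real.norm_eq_abs]
        gcongr
        exact hcoord ω k)
  have hM : 0 < M := by
    refine lt_of_lt_of_le (EReal.coe_pos.2 ht₀) (le_sSup ⟨t₀, ⟨ht₀, ?_⟩, rfl⟩)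
    refine hexp.mono' (by fun_prop) (.of_forall fun ω => ?_)
    rw [Real.norm_of_nonneg (Real.exp_pos _).le]
    gcongr
    exact hcoord ω 0
  have hMint : ∀ t : ℝ, 0 ≤ t → (t : EReal) < M →
      IntegrableOn (fun u => Real.exp (t * |u|)) {u | 1 < ‖u‖} ν₁ := fun t h1 h2 =>
    hX.integrableOn_exp_mul_abs 0 h1 h2
  have hpos1 : 0 < ∫ ω, |X ω 0| ∂P := hX.integral_abs_pos hν₁ 0 (hi1 0)
  have hposX : 0 < ∫ ω, ‖X ω‖ ∂P :=
    hpos1.trans_le (integral_mono (hi1 0) hiX fun ω => hcoord ω 0)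
  have hd : (0 : ℝ) < d := by exact_mod_cast Nat.pos_of_neZero d
  have hc : 0 ≤ 2 * (d : ℝ) / (ε * ∫ ω, ‖X ω‖ ∂P) ^ 2 := by positivity
  have hle2 := sq_integral_norm_le hiX hi2 0 hident
  have hle1 := mul_sq_integral_abs_le hiX hi1 0 hident
  have hrate : ∀ t ∈ D, levyRate (2 * (d : ℝ) / (ε * ∫ ω, ‖X ω‖ ∂P) ^ 2) ν₁ t = h t := by
    intro t ht
    obtain ⟨t', h1, h2⟩ := exists_gt_mem_Ico_ereal ht
    exact hν₁.levyRate_eq ht.1 h1 (hMint t' h2.1 h2.2) _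
  have hν₁0 : ν₁ ≠ 0 := fun h0 => hX.ne_zero (by simp [axisMeasure, h0])
  have hmono : StrictMonoOn h D :=
    (hν₁.strictMonoOn_levyRate hMint hν₁0 hc).congr hrate
  have hcont : ∀ b : ℝ, 0 ≤ b ∧ (b : EReal) < M → ContinuousOn h (Icc 0 b) := fun b hb =>
    (hν₁.continuousOn_levyRate hMint hc hb).congr fun t ht =>
      (hrate t ⟨ht.1, lt_of_le_of_lt (EReal.coe_le_coe_iff.2 ht.2) hb.2⟩).symm
  have h0 : h 0 = 0 := by
    rw [← hrate 0 ⟨le_rfl, by simpa using hM⟩, levyRate_zero]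
  refine ⟨⟨hM, hiX, hposX, fun t ht => ?_⟩, ⟨hi2 0, hpos1, fun t ht => ?_⟩, ?_⟩
  · obtain ⟨t', h1, h2⟩ := exists_gt_mem_Ico_ereal ht
    have h3 := fun (k : ℕ) (hk : 1 ≤ k) =>
      hν₁.integrable_pow_mul_exp_sub_one ht.1 h1 (hMint t' h2.1 h2.2) hk
    exact ⟨by simpa only [pow_one] using h3 1 le_rfl, h3 3 (by norm_num)⟩
  · have hI₃ : 0 ≤ I₃ t := integral_nonneg fun u =>
      mul_nonneg (by positivity) (exp_mul_abs_sub_one_nonneg ht.1 u)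
    have hpos2 : 0 < ∫ ω, X ω 0 ^ 2 ∂P :=
      pos_of_mul_pos_right ((by positivity : (0 : ℝ) < _).trans_le hle2) hd.le
    refine ⟨add_le_add le_rfl (mul_le_mul_of_nonneg_right ?_ hI₃),
      add_le_add le_rfl (mul_le_mul_of_nonneg_right ?_ hI₃)⟩
    · rw [div_le_div_iff₀ (by positivity) (by positivity), mul_pow]
      calc _ = 2 * ε ^ 2 * (∫ ω, ‖X ω‖ ∂P) ^ 2 := by ring
        _ ≤ 2 * ε ^ 2 * (d * ∫ ω, X ω 0 ^ 2 ∂P) := by gcongr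
        _ = _ := by ring
    · rw [div_le_div_iff₀ (by positivity) (by positivity), mul_pow]
      calc _ = 2 * ε ^ 2 * (d * (∫ ω, |X ω 0| ∂P) ^ 2) := by ring
        _ ≤ 2 * ε ^ 2 * (∫ ω, ‖X ω‖ ∂P) ^ 2 := by gcongr
        _ = _ := by ring
  · obtain ⟨L, hlim, hbij⟩ := exists_tendsto_and_bijOn hM hmono hcont h0
    refine ⟨L, hlim, hbij, fun x hx hxL => ?_⟩
    -- The Chernoff parameter is $T=h^{-1}(x)$, the maximizer of $Tx-K(T)$.
    obtain ⟨hT, hint, hle⟩ := integral_invFunOn_le hM hmono h0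
      (levyLog_zero (2 * (d : ℝ) / (ε * ∫ ω, ‖X ω‖ ∂P) ^ 2))
      (fun a b ha hb => hrate b hb ▸ hν₁.levyLog_add_le hMint hc ha hb) hbij hx hxL
    refine ⟨hint, ?_⟩
    -- Some room between `T` and `M` is needed to absorb polynomial factors.
    obtain ⟨t', h1, h2⟩ := exists_gt_mem_Ico_ereal hT
    refine (hX.measure_le_norm_le hν₁ hiX hposX hε hT.1 h1 (hMint t' h2.1 h2.2) hx.le).trans ?_
    refine ENNReal.ofReal_le_ofReal (Real.exp_le_exp.2 ?_)
    linarith
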